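/- Let $T,\delta,R>0$. Consider, in space dimension $n=1$, a third order operator with principal symbol $L(t,\tau,\xi)=\tau^3+\sum_{j=0}^{2}a_j(t)\tau^j\xi^{3-j}$ and symbol of order two $M(t,\tau,\xi)=\sum_{j=0}^{2}b_j(t)\tau^j\xi^{2-j}$, where the coefficients $a_j$ (real-valued) and $b_j$ (complex-valued) are analytic on $]-\delta,T+\delta[$. Assume that for all $t\in[0,T]$ and $\xi\in\mathbb R$ the polynomial $L(t,\cdot,\xi)$ has only real roots $\tau_1(t,\xi)\le\tau_2(t,\xi)\le\tau_3(t,\xi)$ (weak hyperbolicity), and that the discriminant $\Delta_L=(\tau_1-\tau_2)^2(\tau_2-\tau_3)^2(\tau_3-\tau_1)^2$ is not identically zero on $[0,T]\times\mathbb R$. Put $$\widecheck M=M-\tfrac12\,\partial_t\partial_\tau L,$$ let $\lambda_1,\lambda_2,\lambda_3$ be the (real and distinct) roots in $\tau$ of $L-\partial_\tau^2L$, in increasing order, and let $S_3=\{(1,2,3),(2,3,1),(3,1,2)\}$. Then the following two conditions are equivalent. (i) There is a constant $C>0$ such that, for all $\xi\in\mathbb R$ with $|\xi|\ge R$, $$\int_0^T\sum_{(j,k,l)\in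 S_3}\frac{|\widecheck M(t,\lambda_j(t,\xi),\xi)|}{|\lambda_j(t,\xi)-\lambda_k(t,\xi)|\,|\lambda_j(t,\xi)-\lambda_l(t,\xi)|}\,dt\le C\log(1+|\xi|).$$ (ii) There are finitely many (possibly zero) distinct points $t_1,\dots,t_\nu\in\,]-\delta,T+\delta[$ and a constant $C>0$ such that $$\prod_{h=1}^{\nu}|t-t_h|\;|\widecheck M(t,\tau_j(t,\xi),\xi)|\le C\,|\tau_j(t,\xi)-\tau_k(t,\xi)|\,|\tau_j(t,\xi)-\tau_l(t,\xi)|$$ for all $(j,k,l)\in S_3$, all $t\in[0,T]$ and all $\xi\in\mathbb R$. -/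

import Mathlib

open Set Polynomial MeasureTheory

noncomputable section

namespace ThirdOrder

/-- The `j`-th real root, `j = 0, 1, 2, …`, of a real polynomial, the real roots being listed in
nondecreasing order and repeated according to multiplicity. (The value is `0` if there are
at most `j` real roots; this never happens for the split cubic polynomials used below.) -/
def orderedRoot (p : ℝ[X]) (j : ℕ) : ℝ :=
  (p.roots.sort (· ≤ ·)).getD j 0

/-- The principal symbol `L(t, τ, ξ) = τ³ + ∑_{j ≤ 2} a_j(t) τ^j ξ^(3-j)` in one space dimension,
as a polynomial in `τ`; `a j` is the coefficient of `∂_t^j ∂_x^(3-j)`. -/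
def symbolL (a : Fin 3 → ℝ → ℝ) (t ξ : ℝ) : ℝ[X] :=
  X ^ 3 + ∑ j : Fin 3, C (a j t * ξ ^ (3 - (j : ℕ))) * X ^ (j : ℕ)

/-- The symbol of order two `M(t, τ, ξ) = ∑_{j ≤ 2} b_j(t) τ^j ξ^(2-j)`;
`b j` is the (complex) coefficient of `∂_t^j ∂_x^(2-j)`. -/
def symbolM (b : Fin 3 → ℝ → ℂ) (t τ ξ : ℝ) : ℂ :=
  ∑ j : Fin 3, b j t * (τ : ℂ) ^ (j : ℕ) * (ξ : ℂ) ^ (2 - (j : ℕ))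

/-- The subprincipal symbol `M - (1/2) ∂_t ∂_τ L`. -/
def checkM (a : Fin 3 → ℝ → ℝ) (b : Fin 3 → ℝ → ℂ) (t τ ξ : ℝ) : ℂ :=
  symbolM b t τ ξ -
    (1 / 2 : ℂ) * ((deriv (fun s => (derivative (symbolL a s ξ)).eval τ) t : ℝ) : ℂ)

/-- The auxiliary polynomial `L - ∂_τ² L`. -/
def auxL (a : Fin 3 → ℝ → ℝ) (t ξ : ℝ) : ℝ[X] :=
  symbolL a t ξ - derivative (derivative (symbolL a t ξ))

/-- The roots `τ_j(t, ξ)` of `L(t, ·, ξ)`, in nondecreasing order. -/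
def tauRoot (a : Fin 3 → ℝ → ℝ) (j : Fin 3) (t ξ : ℝ) : ℝ :=
  orderedRoot (symbolL a t ξ) j

/-- The roots `λ_j(t, ξ)` of `L - ∂_τ² L`, in nondecreasing order. -/
def lambdaRoot (a : Fin 3 → ℝ → ℝ) (j : Fin 3) (t ξ : ℝ) : ℝ :=
  orderedRoot (auxL a t ξ) j

/-- The discriminant `Δ_L(t, ξ)` of `L`, in terms of its roots. -/
def discrL (a : Fin 3 → ℝ → ℝ) (t ξ : ℝ) : ℝ :=
  (tauRoot a 0 t ξ - tauRoot a 1 t ξ) ^ 2 * (tauRoot a 1 t ξ - tauRoot a 2 t ξ) ^ 2 *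
    (tauRoot a 2 t ξ - tauRoot a 0 t ξ) ^ 2

/-- Weak hyperbolicity on `[0, T]`: all the roots of `L(t, ·, ξ)` are real. -/
def WeaklyHyperbolic (T : ℝ) (a : Fin 3 → ℝ → ℝ) : Prop :=
  ∀ t ∈ Icc 0 T, ∀ ξ : ℝ, (symbolL a t ξ).Splits

/-- The cyclic triples `(1,2,3), (2,3,1), (3,1,2)`, with indices starting from `0`. -/
def S3 : Finset (Fin 3 × Fin 3 × Fin 3) :=
  {(0, 1, 2), (1, 2, 0), (2, 0, 1)}

/-- The integrand of the logarithmic Levi condition on the terms of order two. -/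
def leviIntegrand (a : Fin 3 → ℝ → ℝ) (b : Fin 3 → ℝ → ℂ) (t ξ : ℝ) : ℝ :=
  ∑ i ∈ S3, ‖checkM a b t (lambdaRoot a i.1 t ξ) ξ‖ /
    (|lambdaRoot a i.1 t ξ - lambdaRoot a i.2.1 t ξ| *
      |lambdaRoot a i.1 t ξ - lambdaRoot a i.2.2 t ξ|)

/-- The logarithmic Levi condition on the terms of order two, for the frequencies `|ξ| ≥ R`. -/
def LogLevi (T R : ℝ) (a : Fin 3 → ℝ → ℝ) (b : Fin 3 → ℝ → ℂ) : Prop :=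
  ∃ K > 0, ∀ ξ : ℝ, R ≤ |ξ| →
    IntervalIntegrable (fun t => leviIntegrand a b t ξ) volume 0 T ∧
      ∫ t in (0 : ℝ)..T, leviIntegrand a b t ξ ≤ K * Real.log (1 + |ξ|)

/-- The pointwise Levi condition; the elements of `S` are the (distinct) points `t_1, …, t_ν`. -/
def PointwiseLevi (T δ : ℝ) (a : Fin 3 → ℝ → ℝ) (b : Fin 3 → ℝ → ℂ) : Prop :=
  ∃ S : Finset ℝ, (S : Set ℝ) ⊆ Ioo (-δ) (T + δ) ∧
    ∃ K > 0, ∀ i ∈ S3, ∀ t ∈ Icc 0 T, ∀ ξ : ℝ,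
      (∏ s ∈ S, |t - s|) * ‖checkM a b t (tauRoot a i.1 t ξ) ξ‖ ≤
        K * (|tauRoot a i.1 t ξ - tauRoot a i.2.1 t ξ| *
          |tauRoot a i.1 t ξ - tauRoot a i.2.2 t ξ|)

end ThirdOrder

end

namespace ThirdOrder

/-- `x` lists the three roots of the depressed cubic `X ^ 3 - 3 A X - 2 B`. -/
structure IsRootTriple (A B : ℝ) (x : Fin 3 → ℝ) : Prop where
  sum : x 0 + x 1 + x 2 = 0
  pairs : x 0 * x 1 + x 1 * x 2 + x 2 * x 0 = -3 * A
  prod : x 0 * x 1 * x 2 = 2 * B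

/-- The roots of `X ^ 3 - 3 A X - 2 B` by Viète's trigonometric formula. -/
noncomputable def cubicRoot (A B : ℝ) : Fin 3 → ℝ :=
  let θ := Real.arccos (B / √A ^ 3) / 3
  ![2 * √A * Real.cos θ, √A * (-Real.cos θ + √3 * Real.sin θ),
    √A * (-Real.cos θ - √3 * Real.sin θ)]

theorem isRootTriple_cubicRoot {A B : ℝ} (hA : 0 ≤ A) (hB : B ^ 2 ≤ A ^ 3) :
    IsRootTriple A B (cubicRoot A B) := by
  have hs : √A ^ 2 = A := Real.sq_sqrt hA
  have h3 : √(3 : ℝ) ^ 2 = 3 := Real.sq_sqrt (by norm_num)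
  set θ := Real.arccos (B / √A ^ 3) / 3 with hθ
  have hcs : Real.sin θ ^ 2 = 1 - Real.cos θ ^ 2 := by
    linarith [Real.sin_sq_add_cos_sq θ]
  have hB' : |B| ≤ √A ^ 3 := by
    apply abs_le_of_sq_le_sq _ (by positivity)
    calc B ^ 2 ≤ A ^ 3 := hB
      _ = (√A ^ 2) ^ 3 := by rw [hs]
      _ = (√A ^ 3) ^ 2 := by ring
  have hcos : √A ^ 3 * (4 * Real.cos θ ^ 3 - 3 * Real.cos θ) = B := by
    rw [← Real.cos_three_mul, hθ, mul_div_cancel₀ _ (by norm_num : (3 : ℝ) ≠ 0)]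
    rcases eq_or_lt_of_le (by positivity : 0 ≤ √A ^ 3) with h | h
    · rw [← h] at hB' ⊢
      have : B = 0 := abs_nonpos_iff.mp hB'
      simp [this]
    · obtain ⟨h1, h2⟩ := abs_le.mp hB'
      rw [Real.cos_arccos, mul_div_cancel₀ _ h.ne']
      · rw [le_div_iff₀ h]; linarith
      · rw [div_le_iff₀ h]; linarith
  constructor
  · simp [cubicRoot, ← hθ]; ring
  · simp [cubicRoot, ← hθ]
    linear_combination (-3 * Real.cos θ ^ 2 - 3 * Real.sin θ ^ 2) * hs - 3 * A * hcs -
      (√A ^ 2) * Real.sin θ ^ 2 * h3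
  · simp [cubicRoot, ← hθ]
    linear_combination 2 * hcos - 2 * √A ^ 3 * Real.cos θ * Real.sin θ ^ 2 * h3 -
      6 * √A ^ 3 * Real.cos θ * hcs

theorem continuousOn_cubicRoot {A B : ℝ → ℝ} {s : Set ℝ} (hA : ContinuousOn A s)
    (hB : ContinuousOn B s) (hpos : ∀ t ∈ s, 0 < A t) (k : Fin 3) :
    ContinuousOn (fun t => cubicRoot (A t) (B t) k) s := by
  have hs : ContinuousOn (fun t => √(A t)) s := Real.continuous_sqrt.comp_continuousOn hA
  have hθ : ContinuousOn (fun t => Real.arccos (B t / √(A t) ^ 3) / 3) s :=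
    (Real.continuous_arccos.comp_continuousOn (hB.div (hs.pow 3) fun t ht =>
      pow_ne_zero 3 (Real.sqrt_pos.mpr (hpos t ht)).ne')).div_const 3
  have hc := Real.continuous_cos.comp_continuousOn hθ
  have hsn := Real.continuous_sin.comp_continuousOn hθ
  fin_cases k
  · exact (continuousOn_const.mul hs).mul hc
  · exact hs.mul (hc.neg.add (continuousOn_const.mul hsn))
  · exact hs.mul (hc.neg.sub (continuousOn_const.mul hsn))

namespace IsRootTriple

variable {A B : ℝ} {x : Fin 3 → ℝ}

theorem rotate (h : IsRootTriple A B x) : IsRootTriple A B ![x 1, x 2, x 0] := by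
  obtain ⟨h1, h2, h3⟩ := h
  constructor <;> simp <;> linarith

theorem gap_zero (h : IsRootTriple A B x) :
    (x 0 - x 1) * (x 0 - x 2) = 3 * (x 0 ^ 2 - A) := by
  obtain ⟨h1, h2, h3⟩ := h
  linear_combination h2 - 2 * x 0 * h1

theorem gap_one (h : IsRootTriple A B x) :
    (x 1 - x 2) * (x 1 - x 0) = 3 * (x 1 ^ 2 - A) := h.rotate.gap_zero

theorem gap_two (h : IsRootTriple A B x) :
    (x 2 - x 0) * (x 2 - x 1) = 3 * (x 2 ^ 2 - A) := h.rotate.rotate.gap_zero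

theorem discr (h : IsRootTriple A B x) :
    (x 0 - x 1) ^ 2 * (x 1 - x 2) ^ 2 * (x 2 - x 0) ^ 2 = 108 * (A ^ 3 - B ^ 2) := by
  obtain ⟨h1, h2, h3⟩ := h
  have hA : A = -(x 0 * x 1 + x 1 * x 2 + x 2 * x 0) / 3 := by linarith
  have hB : B = x 0 * x 1 * x 2 / 2 := by linarith
  have h0 : x 2 = -x 0 - x 1 := by linarith
  rw [hA, hB, h0]; ring

theorem sq_sum (h : IsRootTriple A B x) : x 0 ^ 2 + x 1 ^ 2 + x 2 ^ 2 = 6 * A := by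
  obtain ⟨h1, h2, h3⟩ := h
  linear_combination (x 0 + x 1 + x 2) * h1 - 2 * h2

theorem forall_of_zero {p : ℝ → Prop} (h : IsRootTriple A B x)
    (hp : ∀ y : Fin 3 → ℝ, IsRootTriple A B y → p (y 0)) (k : Fin 3) : p (x k) := by
  fin_cases k
  · exact hp x h
  · exact hp _ h.rotate
  · exact hp _ h.rotate.rotate

theorem cube_eq (h : IsRootTriple A B x) (k : Fin 3) : x k ^ 3 = 3 * A * x k + 2 * B := by
  refine h.forall_of_zero (p := fun r => r ^ 3 = 3 * A * r + 2 * B) (fun y hy => ?_) k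
  obtain ⟨h1, h2, h3⟩ := hy
  linear_combination h3 + y 0 ^ 2 * h1 - y 0 * h2

theorem sq_le (h : IsRootTriple A B x) (k : Fin 3) : x k ^ 2 ≤ 6 * A := by
  refine h.forall_of_zero (p := fun r => r ^ 2 ≤ 6 * A) (fun y hy => ?_) k
  nlinarith [hy.sq_sum, sq_nonneg (y 1), sq_nonneg (y 2)]

theorem discr_factor (h : IsRootTriple A B x) :
    |3 * (x 0 ^ 2 - A)| * |3 * (x 1 ^ 2 - A)| * |3 * (x 2 ^ 2 - A)| =
      |108 * (A ^ 3 - B ^ 2)| := by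
  rw [← h.discr, ← abs_mul, ← abs_mul, ← h.gap_zero, ← h.gap_one, ← h.gap_two, ← abs_neg]
  congr 1; ring

theorem deriv_ne_zero (h : IsRootTriple A B x) (hD : A ^ 3 - B ^ 2 ≠ 0) (k : Fin 3) :
    3 * (x k ^ 2 - A) ≠ 0 := by
  have := h.discr_factor
  intro h0
  apply hD
  fin_cases k <;> simp at h0 <;> simp [h0] at this <;> exact this

end IsRootTriple

theorem two_mul_le_sq_gap {A B e : ℝ} {y : Fin 3 → ℝ} (hA : 0 ≤ A) (hB : B ^ 2 ≤ A ^ 3)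
    (he : 0 < e) (hy : IsRootTriple (A + 2 * e) B y) : 2 * e ≤ (y 0 - y 1) ^ 2 := by
  have hd := hy.discr
  have hs := hy.sq_sum
  have h1 := hy.sum
  set E := A + 2 * e with hE
  have hE0 : 0 < E := by linarith
  have hlow : 2 * e * E ^ 2 ≤ E ^ 3 - B ^ 2 := by
    have : E ^ 3 - A ^ 3 = 2 * e * (E ^ 2 + E * A + A ^ 2) := by rw [hE]; ring
    have h2 : 0 ≤ 2 * e * (E * A + A ^ 2) := by positivity
    nlinarith
  have hsum : (y 0 - y 1) ^ 2 + (y 1 - y 2) ^ 2 + (y 2 - y 0) ^ 2 = 18 * E := by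
    linear_combination 3 * hs - (y 0 + y 1 + y 2) * h1
  have hle : (y 1 - y 2) ^ 2 * (y 2 - y 0) ^ 2 ≤ 81 * E ^ 2 := by
    have h2 : (y 1 - y 2) ^ 2 + (y 2 - y 0) ^ 2 ≤ 18 * E := by nlinarith [sq_nonneg (y 0 - y 1)]
    nlinarith [sq_nonneg ((y 1 - y 2) ^ 2 - (y 2 - y 0) ^ 2), sq_nonneg (y 1 - y 2),
      sq_nonneg (y 2 - y 0)]
  by_contra! hlt
  have h5 : (y 0 - y 1) ^ 2 * ((y 1 - y 2) ^ 2 * (y 2 - y 0) ^ 2) ≤ 2 * e * (81 * E ^ 2) :=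
    mul_le_mul hlt.le hle (by positivity) (by positivity)
  have : 0 < e * E ^ 2 := by positivity
  nlinarith

theorem deriv_lower_bounds {A B e : ℝ} {x : Fin 3 → ℝ} (hA : 0 ≤ A) (hB : B ^ 2 ≤ A ^ 3)
    (he : 0 < e) (hx : IsRootTriple (A + 2 * e) B x) (k : Fin 3) :
    2 * e ≤ |3 * (x k ^ 2 - (A + 2 * e))| ∧
      4 * e * x k ^ 2 ≤ |3 * (x k ^ 2 - (A + 2 * e))| ^ 2 := by
  refine hx.forall_of_zero (p := fun r => 2 * e ≤ |3 * (r ^ 2 - (A + 2 * e))| ∧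
    4 * e * r ^ 2 ≤ |3 * (r ^ 2 - (A + 2 * e))| ^ 2) (fun y hy => ?_) k
  rw [← hy.gap_zero]
  have h1 := two_mul_le_sq_gap hA hB he hy
  have h2 : 2 * e ≤ (y 0 - y 2) ^ 2 := by
    have := two_mul_le_sq_gap hA hB he hy.rotate.rotate
    simp at this
    linarith [sq_nonneg (y 0 - y 2), (by ring : (y 2 - y 0) ^ 2 = (y 0 - y 2) ^ 2)]
  have h3 := hy.sum
  have h4 : 3 * y 0 = (y 0 - y 1) + (y 0 - y 2) := by linarith
  have h5 : 2 * e * (2 * e) ≤ (y 0 - y 1) ^ 2 * (y 0 - y 2) ^ 2 :=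
    mul_le_mul h1 h2 (by positivity) (by positivity)
  constructor
  · apply le_of_sq_le_sq _ (abs_nonneg _)
    rw [sq_abs]; nlinarith
  · rw [sq_abs, mul_pow]
    have h6 : 0 ≤ ((y 0 - y 1) ^ 2 - 2 * e) * ((y 0 - y 2) ^ 2 - 2 * e) :=
      mul_nonneg (by linarith) (by linarith)
    have h7 : 9 * y 0 ^ 2 ≤ 2 * ((y 0 - y 1) ^ 2 + (y 0 - y 2) ^ 2) := by
      have : 9 * y 0 ^ 2 = ((y 0 - y 1) + (y 0 - y 2)) ^ 2 := by rw [← h4]; ring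
      linarith [sq_nonneg ((y 0 - y 1) - (y 0 - y 2))]
    have h8 : 0 ≤ e * y 0 ^ 2 := by positivity
    nlinarith [mul_le_mul_of_nonneg_left h7 he.le]

/-- The value at a root `x` of the perturbed cubic of the quotient of `X ^ 3 - 3 A X - 2 B` by
`X - s`. -/
theorem quotient_le_deriv_perturbed {A B e x s : ℝ}
    (he : 0 < e) (hx : x ^ 3 = 3 * (A + 2 * e) * x + 2 * B) (hs : s ^ 3 = 3 * A * s + 2 * B)
    (h1 : 2 * e ≤ |3 * (x ^ 2 - (A + 2 * e))|)
    (h2 : 4 * e * x ^ 2 ≤ |3 * (x ^ 2 - (A + 2 * e))| ^ 2) :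
    |x ^ 2 + x * s + s ^ 2 - 3 * A| ≤ 6 * |3 * (x ^ 2 - (A + 2 * e))| := by
  set q := 3 * (x ^ 2 - (A + 2 * e)) with hq
  set f := x ^ 2 + x * s + s ^ 2 - 3 * A with hf
  have hfx : (x - s) * f = 6 * e * x := by rw [hf]; linear_combination hx - hs
  have hfq : f = q + 6 * e + (s - x) * ((s - x) + 3 * x) := by rw [hf, hq]; ring
  rcases le_or_gt e ((x - s) ^ 2) with h | h
  · apply le_of_sq_le_sq _ (by positivity)
    rw [mul_pow, sq_abs]
    have h3 : e * f ^ 2 ≤ e * (36 * e * x ^ 2) := by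
      calc e * f ^ 2 ≤ (x - s) ^ 2 * f ^ 2 := by gcongr
        _ = ((x - s) * f) ^ 2 := by ring
        _ = e * (36 * e * x ^ 2) := by rw [hfx]; ring
    have h4 := le_of_mul_le_mul_left h3 he
    nlinarith [sq_nonneg |q|]
  · have h3 : |s - x| ≤ √e := by
      apply Real.abs_le_sqrt; nlinarith
    have h4 : √e * √e = e := Real.mul_self_sqrt he.le
    have h5 : √e * |x| ≤ |q| / 2 := by
      apply le_of_sq_le_sq _ (by positivity)
      rw [mul_pow, sq_abs, Real.sq_sqrt he.le]; nlinarith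
    have h6 : |(s - x) * ((s - x) + 3 * x)| ≤ √e * (√e + 3 * |x|) := by
      rw [abs_mul]
      refine mul_le_mul h3 ?_ (abs_nonneg _) (by positivity)
      refine (abs_add_le _ _).trans (add_le_add h3 ?_)
      rw [abs_mul, abs_of_pos (by norm_num : (0 : ℝ) < 3)]
    have h7 : |f| ≤ |q| + 6 * e + √e * (√e + 3 * |x|) := by
      rw [hfq]
      refine (abs_add_le _ _).trans (add_le_add ((abs_add_le _ _).trans ?_) h6)
      rw [abs_of_pos (by positivity : 0 < 6 * e)]
    nlinarith

/-- The value at a root `s` of the cubic of the quotient of the perturbed cubic by `X - x`. -/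
theorem perturbed_quotient_le_deriv {A B e x s K : ℝ}
    (he : 0 < e) (he1 : e ≤ 1) (hx : x ^ 3 = 3 * (A + 2 * e) * x + 2 * B)
    (hs : s ^ 3 = 3 * A * s + 2 * B) (hsK : |s| ≤ K)
    (hq : √e ≤ |3 * (s ^ 2 - A)|) :
    |s ^ 2 + s * x + x ^ 2 - 3 * (A + 2 * e)| ≤ (8 + 6 * K) * |3 * (s ^ 2 - A)| := by
  set q := 3 * (s ^ 2 - A) with hq'
  set f := s ^ 2 + s * x + x ^ 2 - 3 * (A + 2 * e) with hf
  have hfx : (x - s) * f = 6 * e * s := by rw [hf]; linear_combination hx - hs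
  have hfq : f = q - 6 * e + (x - s) * ((x - s) + 3 * s) := by rw [hf, hq']; ring
  have hK : 0 ≤ K := (abs_nonneg _).trans hsK
  have h4 : √e * √e = e := Real.mul_self_sqrt he.le
  have h0 : 0 < √e := Real.sqrt_pos.mpr he
  have h01 : √e ≤ 1 := Real.sqrt_le_one.mpr he1
  rcases le_or_gt (√e) |x - s| with h | h
  · have h3 : √e * |f| ≤ √e * (6 * √e * K) := by
      calc √e * |f| ≤ |x - s| * |f| := by gcongr
        _ = 6 * e * |s| := by
          rw [← abs_mul, hfx, abs_mul, abs_of_pos (by positivity : 0 < 6 * e)]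
        _ ≤ 6 * e * K := by gcongr
        _ = √e * (6 * √e * K) := by linear_combination -6 * K * h4
    have h5 := le_of_mul_le_mul_left h3 h0
    calc |f| ≤ 6 * √e * K := h5
      _ ≤ 6 * |q| * K := by gcongr
      _ ≤ _ := by nlinarith [abs_nonneg q]
  · have h6 : |(x - s) * ((x - s) + 3 * s)| ≤ √e * (√e + 3 * K) := by
      rw [abs_mul]
      refine mul_le_mul h.le ?_ (abs_nonneg _) (by positivity)
      refine (abs_add_le _ _).trans (add_le_add h.le ?_)
      rw [abs_mul, abs_of_pos (by norm_num : (0 : ℝ) < 3)]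
      gcongr
    have h7 : |f| ≤ |q| + 6 * e + √e * (√e + 3 * K) := by
      rw [hfq]
      refine (abs_add_le _ _).trans (add_le_add ((abs_sub _ _).trans ?_) h6)
      rw [abs_of_pos (by positivity : 0 < 6 * e)]
    have h8 : e ≤ |q| := by nlinarith
    have h9 : √e * K ≤ |q| * K := by gcongr
    nlinarith [mul_nonneg (abs_nonneg q) hK]

/-- The quadratic polynomial with coefficients `d`. -/
noncomputable def quad (d : Fin 3 → ℂ) (x : ℝ) : ℂ := d 0 + d 1 * x + d 2 * x ^ 2

/-- The sum of the moduli of the coefficients of the partial fraction decomposition of the quotient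
of `quad d` by the cubic with roots `x`. -/
noncomputable def residueSum (d : Fin 3 → ℂ) (A : ℝ) (x : Fin 3 → ℝ) : ℝ :=
  ∑ k, ‖quad d (x k)‖ / |3 * (x k ^ 2 - A)|

theorem residueSum_nonneg (d : Fin 3 → ℂ) (A : ℝ) (x : Fin 3 → ℝ) : 0 ≤ residueSum d A x :=
  Finset.sum_nonneg fun _ _ => by positivity

theorem quad_eq_lagrange {A B : ℝ} {s : Fin 3 → ℝ} (d : Fin 3 → ℂ) (hs : IsRootTriple A B s)
    (hD : A ^ 3 - B ^ 2 ≠ 0) (x : ℝ) :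
    quad d x = ∑ k, quad d (s k) / ((3 * (s k ^ 2 - A) : ℝ) : ℂ) *
      ((x ^ 2 + x * s k + s k ^ 2 - 3 * A : ℝ) : ℂ) := by
  have g0 := hs.deriv_ne_zero hD 0
  have g1 := hs.deriv_ne_zero hD 1
  rw [← hs.gap_zero] at g0
  rw [← hs.gap_one] at g1
  have n1 : (s 0 : ℂ) - s 1 ≠ 0 := by exact_mod_cast left_ne_zero_of_mul g0
  have n2 : (s 0 : ℂ) - s 2 ≠ 0 := by exact_mod_cast right_ne_zero_of_mul g0
  have n3 : (s 1 : ℂ) - s 2 ≠ 0 := by exact_mod_cast left_ne_zero_of_mul g1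
  have n4 : (s 1 : ℂ) - s 0 ≠ 0 := by exact_mod_cast right_ne_zero_of_mul g1
  have n5 : (s 2 : ℂ) - s 0 ≠ 0 := by rw [← neg_sub]; exact neg_ne_zero.mpr n2
  have n6 : (s 2 : ℂ) - s 1 ≠ 0 := by rw [← neg_sub]; exact neg_ne_zero.mpr n3
  have e0 : x ^ 2 + x * s 0 + s 0 ^ 2 - 3 * A = (x - s 1) * (x - s 2) := by
    linear_combination (x + s 0) * hs.sum - hs.pairs
  have e1 : x ^ 2 + x * s 1 + s 1 ^ 2 - 3 * A = (x - s 2) * (x - s 0) := by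
    linear_combination (x + s 1) * hs.sum - hs.pairs
  have e2 : x ^ 2 + x * s 2 + s 2 ^ 2 - 3 * A = (x - s 0) * (x - s 1) := by
    linear_combination (x + s 2) * hs.sum - hs.pairs
  rw [Fin.sum_univ_three, ← hs.gap_zero, ← hs.gap_one, ← hs.gap_two, e0, e1, e2]
  simp only [quad]
  push_cast
  field_simp
  ring

theorem norm_quad_le {A B C Q : ℝ} {s : Fin 3 → ℝ} (d : Fin 3 → ℂ) (hs : IsRootTriple A B s)
    (hD : A ^ 3 - B ^ 2 ≠ 0) (x : ℝ)
    (h : ∀ k, |x ^ 2 + x * s k + s k ^ 2 - 3 * A| ≤ C * Q) :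
    ‖quad d x‖ ≤ C * Q * residueSum d A s := by
  rw [quad_eq_lagrange d hs hD x, residueSum, Finset.mul_sum]
  refine (norm_sum_le _ _).trans (Finset.sum_le_sum fun k _ => ?_)
  rw [norm_mul, norm_div, Complex.norm_real, Complex.norm_real, Real.norm_eq_abs, Real.norm_eq_abs,
    mul_comm]
  gcongr
  exact h k

theorem residueSum_perturbed_le {A B e : ℝ} {x s : Fin 3 → ℝ} (d : Fin 3 → ℂ) (hA : 0 ≤ A)
    (hB : B ^ 2 ≤ A ^ 3) (hD : A ^ 3 - B ^ 2 ≠ 0) (he : 0 < e)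
    (hx : IsRootTriple (A + 2 * e) B x) (hs : IsRootTriple A B s) :
    residueSum d (A + 2 * e) x ≤ 18 * residueSum d A s := by
  have key : ∀ k ∈ Finset.univ, ‖quad d (x k)‖ / |3 * (x k ^ 2 - (A + 2 * e))| ≤
      6 * residueSum d A s := by
    intro k _
    obtain ⟨h1, h2⟩ := deriv_lower_bounds hA hB he hx k
    rw [div_le_iff₀ (by linarith)]
    have := norm_quad_le d hs hD (x k) fun l =>
      quotient_le_deriv_perturbed he (hx.cube_eq k) (hs.cube_eq l) h1 h2
    linarith
  refine (Finset.sum_le_card_nsmul _ _ _ key).trans (le_of_eq ?_)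
  simp; ring

theorem residueSum_le_perturbed {A B e K : ℝ} {x s : Fin 3 → ℝ} (d : Fin 3 → ℂ) (hA : 0 ≤ A)
    (hB : B ^ 2 ≤ A ^ 3) (hK : ∀ k, |s k| ≤ K) (he : 0 < e) (he1 : e ≤ 1)
    (hx : IsRootTriple (A + 2 * e) B x) (hs : IsRootTriple A B s)
    (hq : ∀ k, √e ≤ |3 * (s k ^ 2 - A)|) :
    residueSum d A s ≤ 3 * (8 + 6 * K) * residueSum d (A + 2 * e) x := by
  have hD : (A + 2 * e) ^ 3 - B ^ 2 ≠ 0 := by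
    have : 0 < (A + 2 * e) ^ 3 - A ^ 3 := by
      have : (A + 2 * e) ^ 3 - A ^ 3 = 6 * A ^ 2 * e + 12 * A * e ^ 2 + 8 * e ^ 3 := by ring
      rw [this]; positivity
    linarith
  have key : ∀ k ∈ Finset.univ, ‖quad d (s k)‖ / |3 * (s k ^ 2 - A)| ≤
      (8 + 6 * K) * residueSum d (A + 2 * e) x := by
    intro k _
    rw [div_le_iff₀ ((Real.sqrt_pos.mpr he).trans_le (hq k))]
    have := norm_quad_le d hx hD (s k) fun l =>
      perturbed_quotient_le_deriv he he1 (hx.cube_eq l) (hs.cube_eq k) (hK k) (hq k)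
    linarith
  refine (Finset.sum_le_card_nsmul _ _ _ key).trans (le_of_eq ?_)
  simp; ring

/-- The numerator of the sum of squares of the residues for a real quadratic polynomial. -/
def realNumerator (A B u₀ u₁ u₂ : ℝ) : ℝ :=
  18 * A * u₀ ^ 2 - 36 * B * (u₀ * u₁) + 18 * A ^ 2 * (u₁ ^ 2 + 2 * u₀ * u₂) -
    36 * A * B * (u₁ * u₂) + (54 * A ^ 3 - 36 * B ^ 2) * u₂ ^ 2

/-- The numerator of the sum of squares of the residues. -/
def numerator (A B : ℝ) (d : Fin 3 → ℂ) : ℝ :=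
  realNumerator A B (d 0).re (d 1).re (d 2).re + realNumerator A B (d 0).im (d 1).im (d 2).im

theorem realNumerator_eq {A B : ℝ} {s : Fin 3 → ℝ} (hs : IsRootTriple A B s) (u₀ u₁ u₂ : ℝ) :
    realNumerator A B u₀ u₁ u₂ =
      (u₀ + u₁ * s 0 + u₂ * s 0 ^ 2) ^ 2 * (s 1 - s 2) ^ 2 +
      (u₀ + u₁ * s 1 + u₂ * s 1 ^ 2) ^ 2 * (s 2 - s 0) ^ 2 +
      (u₀ + u₁ * s 2 + u₂ * s 2 ^ 2) ^ 2 * (s 0 - s 1) ^ 2 := by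
  obtain ⟨h1, h2, h3⟩ := hs
  have hA : A = -(s 0 * s 1 + s 1 * s 2 + s 2 * s 0) / 3 := by linarith
  have hB : B = s 0 * s 1 * s 2 / 2 := by linarith
  have h0 : s 2 = -s 0 - s 1 := by linarith
  rw [realNumerator, hA, hB, h0]; ring

theorem sum_sq_residue_eq {A B : ℝ} {s : Fin 3 → ℝ} (d : Fin 3 → ℂ) (hs : IsRootTriple A B s)
    (hD : A ^ 3 - B ^ 2 ≠ 0) :
    ∑ k, (‖quad d (s k)‖ / |3 * (s k ^ 2 - A)|) ^ 2 =
      numerator A B d / (108 * (A ^ 3 - B ^ 2)) := by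
  have g0 := hs.deriv_ne_zero hD 0
  have g1 := hs.deriv_ne_zero hD 1
  rw [← hs.gap_zero] at g0
  rw [← hs.gap_one] at g1
  have n1 := left_ne_zero_of_mul g0
  have n2 := right_ne_zero_of_mul g0
  have n3 := left_ne_zero_of_mul g1
  have n4 := right_ne_zero_of_mul g1
  have n5 : s 2 - s 0 ≠ 0 := by rw [← neg_sub]; exact neg_ne_zero.mpr n2
  have n6 : s 2 - s 1 ≠ 0 := by rw [← neg_sub]; exact neg_ne_zero.mpr n3
  have hn : ∀ k, ‖quad d (s k)‖ ^ 2 = ((d 0).re + (d 1).re * s k + (d 2).re * s k ^ 2) ^ 2 +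
      ((d 0).im + (d 1).im * s k + (d 2).im * s k ^ 2) ^ 2 := by
    intro k
    have : quad d (s k) = ⟨(d 0).re + (d 1).re * s k + (d 2).re * s k ^ 2,
        (d 0).im + (d 1).im * s k + (d 2).im * s k ^ 2⟩ := by
      apply Complex.ext <;> simp [quad, ← Complex.ofReal_pow]
    rw [Complex.sq_norm, this, Complex.normSq_mk]; ring
  simp only [Fin.sum_univ_three, div_pow, sq_abs, hn]
  rw [numerator, realNumerator_eq hs, realNumerator_eq hs, ← hs.discr, ← hs.gap_zero,
    ← hs.gap_one, ← hs.gap_two]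
  rw [show s 0 - s 1 = -(s 1 - s 0) by ring, show s 0 - s 2 = -(s 2 - s 0) by ring,
    show s 2 - s 1 = -(s 1 - s 2) by ring]
  field_simp
  ring

theorem arsinh_le_log {x : ℝ} (hx : 0 ≤ x) : Real.arsinh x ≤ Real.log (1 + 2 * x) := by
  rw [Real.arsinh]
  apply Real.log_le_log (by positivity)
  have : √(1 + x ^ 2) ≤ 1 + x := by
    rw [Real.sqrt_le_left (by positivity)]; nlinarith
  linarith

theorem integral_inv_sqrt_le {T s D e : ℝ} (he : 0 < e) (h0 : |s| ≤ D) (h1 : |T - s| ≤ D) :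
    ∫ t in (0 : ℝ)..T, (√(1 + ((t - s) / e) ^ 2))⁻¹ / e ≤ 2 * Real.log (1 + 2 * (D / e)) := by
  have hD : 0 ≤ D := (abs_nonneg _).trans h0
  have hderiv : ∀ t ∈ uIcc 0 T, HasDerivAt (fun t => Real.arsinh ((t - s) / e))
      ((√(1 + ((t - s) / e) ^ 2))⁻¹ / e) t := by
    intro t _
    have h : HasDerivAt (fun t => (t - s) / e) (1 / e) t :=
      ((hasDerivAt_id t).sub_const s).div_const e
    refine h.arsinh.congr_deriv ?_
    rw [smul_eq_mul, mul_one_div]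
  have hc : Continuous fun t : ℝ => (√(1 + ((t - s) / e) ^ 2))⁻¹ / e := by
    refine Continuous.div_const (Continuous.inv₀ (by fun_prop) fun t => ?_) e
    positivity
  rw [intervalIntegral.integral_eq_sub_of_hasDerivAt hderiv (hc.intervalIntegrable _ _)]
  have key : ∀ y, |y| ≤ D → Real.arsinh (y / e) ≤ Real.log (1 + 2 * (D / e)) := fun y hy =>
    (Real.arsinh_le_arsinh.mpr (by gcongr; exact (le_abs_self y).trans hy)).trans
      (arsinh_le_log (by positivity))
  have h2 := key (T - s) h1
  have h3 := key s h0
  have h4 : (0 - s) / e = -(s / e) := by ring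
  rw [h4, Real.arsinh_neg]
  linarith

theorem le_sum_inv_sqrt {S : Finset ℝ} {C e t f : ℝ} (hC : 0 ≤ C) (he : 0 < e)
    (h1 : f ≤ C / e) (h2 : t ∉ S → f ≤ C * ∑ s ∈ S, |t - s|⁻¹) :
    f ≤ ∑ s ∈ S, 2 * C * ((√(1 + ((t - s) / e) ^ 2))⁻¹ / e) := by
  have hterm : ∀ u : ℝ, (e + |u|)⁻¹ ≤ (√(1 + (u / e) ^ 2))⁻¹ / e := by
    intro u
    rw [div_eq_mul_inv, ← mul_inv]
    apply inv_anti₀ (by positivity)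
    have h : √(1 + (u / e) ^ 2) ≤ 1 + |u| / e := by
      rw [Real.sqrt_le_left (by positivity), div_pow, ← sq_abs u, ← div_pow]
      nlinarith [show 0 ≤ |u| / e by positivity]
    calc √(1 + (u / e) ^ 2) * e ≤ (1 + |u| / e) * e := by gcongr
      _ = e + |u| := by field_simp
  by_cases h : ∃ s ∈ S, |t - s| ≤ e
  · obtain ⟨s, hs, hse⟩ := h
    calc f ≤ C / e := h1
      _ = 2 * C * (e + e)⁻¹ := by field_simp; norm_num
      _ ≤ 2 * C * (e + |t - s|)⁻¹ := by gcongr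
      _ ≤ 2 * C * ((√(1 + ((t - s) / e) ^ 2))⁻¹ / e) := by gcongr; exact hterm _
      _ ≤ _ := Finset.single_le_sum (f := fun s => 2 * C * ((√(1 + ((t - s) / e) ^ 2))⁻¹ / e))
        (fun _ _ => by positivity) hs
  · push Not at h
    have ht : t ∉ S := fun hts => by
      have := h t hts
      simp at this; linarith
    refine (h2 ht).trans ?_
    rw [Finset.mul_sum]
    refine Finset.sum_le_sum fun s hs => ?_
    have hlt := h s hs
    have hpos : 0 < |t - s| := he.trans hlt
    calc C * |t - s|⁻¹ = 2 * C * (|t - s| + |t - s|)⁻¹ := by field_simp; norm_num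
      _ ≤ 2 * C * (e + |t - s|)⁻¹ := by gcongr
      _ ≤ _ := by gcongr; exact hterm _

theorem exists_inv_prod_le_sum {S : Finset ℝ} (hS : S.Nonempty) :
    ∃ W, 0 ≤ W ∧ ∀ t ∉ S, (∏ s ∈ S, |t - s|)⁻¹ ≤ W * ∑ s ∈ S, |t - s|⁻¹ := by
  refine ⟨∑ s ∈ S, |Lagrange.nodalWeight S id s|, Finset.sum_nonneg fun _ _ => abs_nonneg _,
    fun t ht => ?_⟩
  have hne : ∀ s ∈ S, t ≠ s := fun s hs h => ht (h ▸ hs)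
  have hpos : 0 < ∏ s ∈ S, |t - s| :=
    Finset.prod_pos fun s hs => abs_pos.mpr (sub_ne_zero.mpr (hne s hs))
  have h1 := Lagrange.eval_interpolate_not_at_node (s := S) (v := id) (fun _ => (1 : ℝ))
    (x := t) hne
  have h2 : Lagrange.interpolate S (id : ℝ → ℝ) (fun _ => (1 : ℝ)) = 1 :=
    Lagrange.interpolate_one Function.injective_id.injOn hS
  rw [h2, Polynomial.eval_one, Lagrange.eval_nodal] at h1
  simp only [id, mul_one] at h1
  rw [inv_le_iff_one_le_mul₀' hpos]
  calc (1 : ℝ) = |∏ s ∈ S, (t - s)| * |∑ i ∈ S, Lagrange.nodalWeight S id i * (t - i)⁻¹| := by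
        rw [← abs_mul, ← h1, abs_one]
    _ = (∏ s ∈ S, |t - s|) * |∑ i ∈ S, Lagrange.nodalWeight S id i * (t - i)⁻¹| := by
        rw [Finset.abs_prod]
    _ ≤ _ := by
        gcongr
        refine (Finset.abs_sum_le_sum_abs _ _).trans ?_
        rw [Finset.mul_sum]
        refine Finset.sum_le_sum fun s hs => ?_
        rw [abs_mul, abs_inv]
        gcongr
        exact Finset.single_le_sum (f := fun s => |Lagrange.nodalWeight S id s|)
          (fun _ _ => abs_nonneg _) hs

/-- The sum of the moduli of the residues for the perturbed cubic, as a function of time. -/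
noncomputable def perturbedResidue (A B : ℝ → ℝ) (d : ℝ → Fin 3 → ℂ) (e t : ℝ) : ℝ :=
  residueSum (d t) (A t + 2 * e) (cubicRoot (A t + 2 * e) (B t))

section

variable {A B : ℝ → ℝ} {d : ℝ → Fin 3 → ℂ} {T : ℝ}

theorem isRootTriple_perturbed {A B e : ℝ} (hA : 0 ≤ A) (hB : B ^ 2 ≤ A ^ 3) (he : 0 ≤ e) :
    IsRootTriple (A + 2 * e) B (cubicRoot (A + 2 * e) B) := by
  apply isRootTriple_cubicRoot (by positivity)
  refine hB.trans ?_
  gcongr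
  linarith

theorem continuousOn_perturbedResidue (hA : ContinuousOn A (Icc 0 T))
    (hB : ContinuousOn B (Icc 0 T)) (hd : ∀ j, ContinuousOn (fun t => d t j) (Icc 0 T))
    (hA0 : ∀ t ∈ Icc 0 T, 0 ≤ A t) (hAB : ∀ t ∈ Icc 0 T, B t ^ 2 ≤ A t ^ 3) {e : ℝ} (he : 0 < e) :
    ContinuousOn (perturbedResidue A B d e) (Icc 0 T) := by
  have hA' : ContinuousOn (fun t => A t + 2 * e) (Icc 0 T) := hA.add continuousOn_const
  unfold perturbedResidue residueSum
  refine continuousOn_finsetSum _ fun k _ => ?_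
  have hx := continuousOn_cubicRoot hA' hB
    (fun t ht => by linarith [hA0 t ht]) k
  have hxc : ContinuousOn (fun t => ((cubicRoot (A t + 2 * e) (B t) k : ℝ) : ℂ)) (Icc 0 T) :=
    Complex.continuous_ofReal.comp_continuousOn hx
  refine ContinuousOn.div ?_ ?_ ?_
  · exact (((hd 0).add ((hd 1).mul hxc)).add ((hd 2).mul (hxc.pow 2))).norm
  · exact (continuousOn_const.mul ((hx.pow 2).sub hA')).abs
  · intro t ht
    have := (deriv_lower_bounds (hA0 t ht) (hAB t ht) he
      (isRootTriple_perturbed (hA0 t ht) (hAB t ht) he.le) k).1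
    linarith

theorem norm_quad_le_of_bounds {d : Fin 3 → ℂ} {x M X : ℝ} (hd : ∀ j, ‖d j‖ ≤ M) (hx : |x| ≤ X) :
    ‖quad d x‖ ≤ M * (1 + X + X ^ 2) := by
  have hM : 0 ≤ M := (norm_nonneg _).trans (hd 0)
  have hX : 0 ≤ X := (abs_nonneg _).trans hx
  have h1 : ‖(x : ℂ)‖ ≤ X := by simpa using hx
  calc ‖quad d x‖ ≤ ‖d 0‖ + ‖d 1‖ * ‖(x : ℂ)‖ + ‖d 2‖ * ‖(x : ℂ)‖ ^ 2 := by
        rw [quad, ← norm_pow, ← norm_mul, ← norm_mul]; exact norm_add₃_le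
    _ ≤ M + M * X + M * X ^ 2 := by
        gcongr
        exacts [hd 0, hd 1, hd 2]
    _ = _ := by ring

theorem exists_coefficient_bound (hd : ∀ j, ContinuousOn (fun t => d t j) (Icc 0 T)) :
    ∃ M, 0 ≤ M ∧ ∀ t ∈ Icc 0 T, ∀ j, ‖d t j‖ ≤ M := by
  have hd' : ContinuousOn d (Icc 0 T) := continuousOn_pi.mpr hd
  obtain ⟨M, hM⟩ := isCompact_Icc.exists_bound_of_continuousOn hd'
  exact ⟨max M 0, le_max_right _ _, fun t ht j =>
    ((norm_le_pi_norm (d t) j).trans (hM t ht)).trans (le_max_left _ _)⟩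

theorem exists_perturbedResidue_le_inv (hA : ContinuousOn A (Icc 0 T))
    (hd : ∀ j, ContinuousOn (fun t => d t j) (Icc 0 T))
    (hA0 : ∀ t ∈ Icc 0 T, 0 ≤ A t) (hAB : ∀ t ∈ Icc 0 T, B t ^ 2 ≤ A t ^ 3) (E : ℝ) :
    ∃ C, 0 ≤ C ∧ ∀ e, 0 < e → e ≤ E → ∀ t ∈ Icc 0 T, perturbedResidue A B d e t ≤ C / e := by
  obtain ⟨M, hM0, hM⟩ := exists_coefficient_bound hd
  obtain ⟨N, hN⟩ := isCompact_Icc.exists_bound_of_continuousOn hA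
  set X := √(6 * (N + 2 * E))
  refine ⟨3 * (M * (1 + X + X ^ 2)), by positivity, fun e he heE t ht => ?_⟩
  have hx := isRootTriple_perturbed (hA0 t ht) (hAB t ht) he.le
  have key : ∀ k ∈ Finset.univ, ‖quad (d t) (cubicRoot (A t + 2 * e) (B t) k)‖ /
      |3 * (cubicRoot (A t + 2 * e) (B t) k ^ 2 - (A t + 2 * e))| ≤ M * (1 + X + X ^ 2) / e := by
    intro k _
    have h1 := (deriv_lower_bounds (hA0 t ht) (hAB t ht) he hx k).1
    have hX : |cubicRoot (A t + 2 * e) (B t) k| ≤ X := by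
      apply Real.abs_le_sqrt
      refine (hx.sq_le k).trans ?_
      have := (le_abs_self _).trans (hN t ht)
      gcongr
    gcongr
    · exact norm_quad_le_of_bounds (hM t ht) hX
    · linarith
  refine (Finset.sum_le_card_nsmul _ _ _ key).trans (le_of_eq ?_)
  simp; ring

theorem exists_log_bound {R : ℝ} (hR : 0 < R) (D : ℝ) (hD : 0 ≤ D) :
    ∃ C, 0 ≤ C ∧ ∀ ξ : ℝ, R ≤ |ξ| →
      2 * Real.log (1 + 2 * (D / (1 / ξ ^ 2))) ≤ C * Real.log (1 + |ξ|) := by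
  have hlR : 0 < Real.log (1 + R) := Real.log_pos (by linarith)
  have hlD : 0 ≤ Real.log (1 + 2 * D) := Real.log_nonneg (by linarith)
  refine ⟨2 * (Real.log (1 + 2 * D) / Real.log (1 + R) + 2), by positivity, fun ξ hξ => ?_⟩
  have h1 : 1 + 2 * (D / (1 / ξ ^ 2)) ≤ (1 + 2 * D) * (1 + |ξ|) ^ 2 := by
    rw [div_div_eq_mul_div, div_one, ← sq_abs]
    nlinarith [abs_nonneg ξ, mul_nonneg hD (abs_nonneg ξ)]
  have h2 : Real.log (1 + R) ≤ Real.log (1 + |ξ|) := Real.log_le_log (by linarith) (by linarith)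
  have h3 := Real.log_le_log (by positivity) h1
  rw [Real.log_mul (by positivity) (by positivity), Real.log_pow] at h3
  have h4 : Real.log (1 + 2 * D) ≤
      Real.log (1 + 2 * D) / Real.log (1 + R) * Real.log (1 + |ξ|) := by
    rw [div_mul_eq_mul_div, le_div_iff₀ hlR]; gcongr
  push_cast at h3
  linarith

theorem exists_integral_perturbedResidue_le {R : ℝ} (hT : 0 < T) (hR : 0 < R)
    (hA : ContinuousOn A (Icc 0 T))
    (hB : ContinuousOn B (Icc 0 T)) (hd : ∀ j, ContinuousOn (fun t => d t j) (Icc 0 T))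
    (hA0 : ∀ t ∈ Icc 0 T, 0 ≤ A t) (hAB : ∀ t ∈ Icc 0 T, B t ^ 2 ≤ A t ^ 3)
    (hfin : {t ∈ Icc 0 T | A t ^ 3 - B t ^ 2 = 0}.Finite) {S : Finset ℝ} {K : ℝ} (hK : 0 < K)
    (hS : ∀ t ∈ Icc 0 T, ∀ k, (∏ s ∈ S, |t - s|) * ‖quad (d t) (cubicRoot (A t) (B t) k)‖ ≤
      K * |3 * (cubicRoot (A t) (B t) k ^ 2 - A t)|) :
    ∃ C > 0, ∀ ξ : ℝ, R ≤ |ξ| →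
      IntervalIntegrable (perturbedResidue A B d (1 / ξ ^ 2)) volume 0 T ∧
      ∫ t in (0 : ℝ)..T, perturbedResidue A B d (1 / ξ ^ 2) t ≤ C * Real.log (1 + |ξ|) := by
  obtain ⟨C₁, hC₁0, hC₁⟩ := exists_perturbedResidue_le_inv hA hd hA0 hAB (1 / R ^ 2)
  set S' := insert 0 S with hS'
  have hne : S'.Nonempty := Finset.insert_nonempty _ _
  obtain ⟨W, hW0, hW⟩ := exists_inv_prod_le_sum hne
  obtain ⟨D, hD0, hD⟩ : ∃ D, 0 ≤ D ∧ ∀ s ∈ S', |s| ≤ D ∧ |T - s| ≤ D := by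
    refine ⟨T + ∑ s ∈ S', |s|, by positivity, fun s hs => ?_⟩
    have := Finset.single_le_sum (f := fun s : ℝ => |s|) (fun _ _ => abs_nonneg _) hs
    refine ⟨by linarith, (abs_sub _ _).trans ?_⟩
    rw [abs_of_pos hT]; linarith
  obtain ⟨C₂, hC₂0, hC₂⟩ := exists_log_bound hR D hD0
  have hprod : ∀ t ∈ Icc 0 T, ∏ s ∈ S', |t - s| ≤ (1 + T) * ∏ s ∈ S, |t - s| := by
    intro t ht
    have hP : 0 ≤ ∏ s ∈ S, |t - s| := Finset.prod_nonneg fun _ _ => abs_nonneg _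
    by_cases h : (0 : ℝ) ∈ S
    · rw [hS', Finset.insert_eq_of_mem h]; nlinarith
    · rw [hS', Finset.prod_insert h, sub_zero, abs_of_nonneg ht.1]
      gcongr
      linarith [ht.2]
  set C₀ := 18 * (3 * (K * (1 + T))) * W with hC₀
  set C := C₁ + C₀ with hC
  have hC₀0 : 0 ≤ C₀ := by positivity
  have hC0 : 0 ≤ C := by positivity
  have hbound : ∀ e, 0 < e → e ≤ 1 / R ^ 2 → ∀ t ∈ Icc 0 T, A t ^ 3 - B t ^ 2 ≠ 0 →
      perturbedResidue A B d e t ≤ ∑ s ∈ S', 2 * C * ((√(1 + ((t - s) / e) ^ 2))⁻¹ / e) := by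
    intro e he heR t ht hDt
    refine le_sum_inv_sqrt hC0 he ((hC₁ e he heR t ht).trans ?_) fun htS => ?_
    · gcongr; linarith
    · have hs := isRootTriple_cubicRoot (hA0 t ht) (hAB t ht)
      refine (residueSum_perturbed_le (d t) (hA0 t ht) (hAB t ht) hDt he
        (isRootTriple_perturbed (hA0 t ht) (hAB t ht) he.le) hs).trans ?_
      have hpos : 0 < ∏ s ∈ S', |t - s| := Finset.prod_pos fun s hs =>
        abs_pos.mpr (sub_ne_zero.mpr fun h => htS (h ▸ hs))
      have key : ∀ k ∈ Finset.univ, ‖quad (d t) (cubicRoot (A t) (B t) k)‖ /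
          |3 * (cubicRoot (A t) (B t) k ^ 2 - A t)| ≤ K * (1 + T) * (∏ s ∈ S', |t - s|)⁻¹ := by
        intro k _
        rw [div_le_iff₀ (abs_pos.mpr (hs.deriv_ne_zero hDt k)), mul_right_comm,
          ← div_eq_mul_inv, le_div_iff₀ hpos]
        have h1 := hS t ht k
        have h2 := mul_le_mul_of_nonneg_left (hprod t ht)
          (norm_nonneg (quad (d t) (cubicRoot (A t) (B t) k)))
        nlinarith [mul_le_mul_of_nonneg_left h1 (by linarith : 0 ≤ 1 + T)]
      have h3 := Finset.sum_le_card_nsmul _ _ _ key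
      simp only [Finset.card_univ, Fintype.card_fin, nsmul_eq_mul, Nat.cast_ofNat] at h3
      have h0 : 0 ≤ ∑ s ∈ S', |t - s|⁻¹ := Finset.sum_nonneg fun _ _ => by positivity
      calc 18 * residueSum (d t) (A t) (cubicRoot (A t) (B t))
          ≤ 18 * (3 * (K * (1 + T) * (∏ s ∈ S', |t - s|)⁻¹)) := by gcongr; exact h3
        _ ≤ 18 * (3 * (K * (1 + T) * (W * ∑ s ∈ S', |t - s|⁻¹))) := by gcongr; exact hW t htS
        _ = C₀ * ∑ s ∈ S', |t - s|⁻¹ := by rw [hC₀]; ring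
        _ ≤ C * ∑ s ∈ S', |t - s|⁻¹ := by gcongr; linarith
  refine ⟨S'.card * (2 * C * C₂) + 1, by positivity, fun ξ hξ => ?_⟩
  have hξ0 : 0 < ξ ^ 2 := by rw [← sq_abs]; exact pow_pos (hR.trans_le hξ) 2
  set e := 1 / ξ ^ 2 with he
  have he0 : 0 < e := by positivity
  have heR : e ≤ 1 / R ^ 2 := by
    rw [he, ← sq_abs ξ]; gcongr
  have hint : IntervalIntegrable (perturbedResidue A B d e) volume 0 T := by
    apply ContinuousOn.intervalIntegrable
    rw [uIcc_of_le hT.le]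
    exact continuousOn_perturbedResidue hA hB hd hA0 hAB he0
  refine ⟨hint, ?_⟩
  have hintg : ∀ s : ℝ, IntervalIntegrable
      (fun t : ℝ => 2 * C * ((√(1 + ((t - s) / e) ^ 2))⁻¹ / e)) volume 0 T := by
    intro s
    refine Continuous.intervalIntegrable ?_ _ _
    refine Continuous.mul continuous_const (Continuous.div_const (Continuous.inv₀ (by fun_prop)
      fun t => ?_) e)
    positivity
  have hlog : 0 ≤ Real.log (1 + |ξ|) := Real.log_nonneg (by linarith [abs_nonneg ξ])
  calc ∫ t in (0 : ℝ)..T, perturbedResidue A B d e t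
      ≤ ∫ t in (0 : ℝ)..T, ∑ s ∈ S', 2 * C * ((√(1 + ((t - s) / e) ^ 2))⁻¹ / e) := by
        refine intervalIntegral.integral_mono_ae_restrict hT.le hint ?_ ?_
        · have := IntervalIntegrable.sum S' (fun s _ => hintg s)
          exact this.congr fun t _ => by simp
        · have h1 : ∀ᵐ t, t ∉ {t ∈ Icc 0 T | A t ^ 3 - B t ^ 2 = 0} :=
            measure_eq_zero_iff_ae_notMem.mp (hfin.measure_zero volume)
          filter_upwards [ae_restrict_mem measurableSet_Icc, ae_restrict_of_ae h1] with t ht h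
          exact hbound e he0 heR t ht fun h0 => h ⟨ht, h0⟩
    _ = ∑ s ∈ S', 2 * C * ∫ t in (0 : ℝ)..T, (√(1 + ((t - s) / e) ^ 2))⁻¹ / e := by
        rw [intervalIntegral.integral_finsetSum fun s _ => hintg s]
        simp only [intervalIntegral.integral_const_mul]
    _ ≤ ∑ s ∈ S', 2 * C * (C₂ * Real.log (1 + |ξ|)) := by
        refine Finset.sum_le_sum fun s hs => ?_
        gcongr
        exact (integral_inv_sqrt_le he0 (hD s hs).1 (hD s hs).2).trans (hC₂ ξ hξ)
    _ = S'.card * (2 * C * C₂) * Real.log (1 + |ξ|) := by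
        rw [Finset.sum_const, nsmul_eq_mul]; ring
    _ ≤ _ := by gcongr; linarith

end

open Filter Topology

theorem IsRootTriple.discr_le_deriv {A B K : ℝ} {s : Fin 3 → ℝ} (hs : IsRootTriple A B s)
    (hA : 0 ≤ A) (hAK : A ≤ K ^ 2) (hK : ∀ k, |s k| ≤ K) (k : Fin 3) :
    3 * (A ^ 3 - B ^ 2) ≤ K ^ 4 * |3 * (s k ^ 2 - A)| := by
  have hle : ∀ k, |3 * (s k ^ 2 - A)| ≤ 6 * K ^ 2 := by
    intro k
    have h1 : s k ^ 2 ≤ K ^ 2 := sq_le_sq' (neg_le_of_abs_le (hK k)) (le_of_abs_le (hK k))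
    rw [abs_le]
    constructor <;> nlinarith [sq_nonneg (s k)]
  have hd := hs.discr_factor
  have h2 := le_abs_self (108 * (A ^ 3 - B ^ 2))
  rw [← hd] at h2
  have key : ∀ p q r : ℝ, 0 ≤ p → 0 ≤ q → 0 ≤ r → q ≤ 6 * K ^ 2 → r ≤ 6 * K ^ 2 →
      p * (q * r) ≤ p * (36 * K ^ 4) := by
    intro p q r hp hq hr h1 h2
    apply mul_le_mul_of_nonneg_left _ hp
    calc q * r ≤ (6 * K ^ 2) * (6 * K ^ 2) := by gcongr
      _ = _ := by ring
  have a0 := abs_nonneg (3 * (s 0 ^ 2 - A))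
  have a1 := abs_nonneg (3 * (s 1 ^ 2 - A))
  have a2 := abs_nonneg (3 * (s 2 ^ 2 - A))
  fin_cases k
  · have := key _ _ _ a0 a1 a2 (hle 1) (hle 2)
    simp only [Fin.zero_eta]; linarith
  · have := key _ _ _ a1 a0 a2 (hle 0) (hle 2)
    simp only [Fin.mk_one]; linarith
  · have := key _ _ _ a2 a0 a1 (hle 0) (hle 1)
    simp only [Fin.reduceFinMk]; linarith

theorem le_residueSum_of_sq_le {A B r : ℝ} {s : Fin 3 → ℝ} {d : Fin 3 → ℂ}
    (hs : IsRootTriple A B s) (hD : A ^ 3 - B ^ 2 ≠ 0)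
    (h : r ^ 2 ≤ numerator A B d / (108 * (A ^ 3 - B ^ 2))) : r ≤ residueSum d A s := by
  apply le_of_sq_le_sq _ (residueSum_nonneg _ _ _)
  rw [← sum_sq_residue_eq d hs hD] at h
  exact h.trans (Finset.sum_sq_le_sq_sum_of_nonneg fun k _ => by positivity)

theorem not_eventually_le_log {c C L : ℝ} (hc : 0 < c) (n : ℕ) :
    ¬ ∀ᶠ Y : ℝ in atTop, c * Y ≤ C * (L + n * Real.log Y) := by
  intro h
  have h1 : Tendsto (fun Y : ℝ => Real.log Y / Y) atTop (𝓝 0) :=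
    Real.isLittleO_log_id_atTop.tendsto_div_nhds_zero
  have h2 : Tendsto (fun Y : ℝ => C * (L * Y⁻¹ + n * (Real.log Y / Y))) atTop
      (𝓝 (C * (L * 0 + n * 0))) :=
    ((tendsto_inv_atTop_zero.const_mul L).add (h1.const_mul (n : ℝ))).const_mul C
  rw [mul_zero, mul_zero, add_zero, mul_zero] at h2
  obtain ⟨Y, hY, hY2, hY0⟩ := (h.and ((h2.eventually_lt_const hc).and
    (eventually_gt_atTop 0))).exists
  have : C * (L * Y⁻¹ + n * (Real.log Y / Y)) * Y = C * (L + n * Real.log Y) := by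
    field_simp
  nlinarith

section

variable {A B : ℝ → ℝ} {d : ℝ → Fin 3 → ℂ} {T : ℝ}

theorem exists_subinterval {T z x : ℝ} (hz : z ∈ Icc 0 T) (hx : 0 ≤ x) (hxT : 4 * x ≤ T) :
    ∃ p q, 0 ≤ p ∧ p ≤ q ∧ q ≤ T ∧ q - p = x ∧ ∀ t ∈ Icc p q, x ≤ |t - z| ∧ |t - z| ≤ 2 * x := by
  rcases le_total z (T / 2) with h | h
  · refine ⟨z + x, z + 2 * x, by linarith [hz.1], by linarith, by linarith, by ring,
      fun t ht => ?_⟩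
    rw [abs_of_nonneg (by linarith [ht.1])]
    constructor <;> linarith [ht.1, ht.2]
  · refine ⟨z - 2 * x, z - x, by linarith, by linarith, by linarith [hz.2], by ring,
      fun t ht => ?_⟩
    rw [abs_of_nonpos (by linarith [ht.2])]
    constructor <;> linarith [ht.1, ht.2]

theorem exists_root_bound (hA : ContinuousOn A (Icc 0 T))
    (hA0 : ∀ t ∈ Icc 0 T, 0 ≤ A t) (hAB : ∀ t ∈ Icc 0 T, B t ^ 2 ≤ A t ^ 3) :
    ∃ K, 0 < K ∧ ∀ t ∈ Icc 0 T, A t ≤ K ^ 2 ∧ ∀ k, |cubicRoot (A t) (B t) k| ≤ K := by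
  obtain ⟨N, hN⟩ := isCompact_Icc.exists_bound_of_continuousOn hA
  have hN' : ∀ t ∈ Icc 0 T, 6 * A t ≤ 6 * |N| + 1 := fun t ht => by
    linarith [le_abs_self (A t), hN t ht, Real.norm_eq_abs (A t), le_abs_self N]
  refine ⟨√(6 * |N| + 1), by positivity, fun t ht => ⟨?_, fun k => ?_⟩⟩
  · rw [Real.sq_sqrt (by positivity)]
    linarith [hA0 t ht, hN' t ht]
  · exact Real.abs_le_sqrt
      (((isRootTriple_cubicRoot (hA0 t ht) (hAB t ht)).sq_le k).trans (hN' t ht))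

theorem not_log_of_strong_singularity {R : ℝ} (hT : 0 < T) (hR : 0 < R)
    (hA : ContinuousOn A (Icc 0 T))
    (hA0 : ∀ t ∈ Icc 0 T, 0 ≤ A t) (hAB : ∀ t ∈ Icc 0 T, B t ^ 2 ≤ A t ^ 3)
    {C : ℝ} (hC : 0 ≤ C) (hlog : ∀ ξ : ℝ, R ≤ |ξ| →
      IntervalIntegrable (perturbedResidue A B d (1 / ξ ^ 2)) volume 0 T ∧
      ∫ t in (0 : ℝ)..T, perturbedResidue A B d (1 / ξ ^ 2) t ≤ C * Real.log (1 + |ξ|))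
    {z c η : ℝ} {n : ℕ} (hn : n ≠ 0) (hz : z ∈ Icc 0 T) (hc : 0 < c) (hη : 0 < η)
    (hDlow : ∀ t ∈ Icc 0 T, t ≠ z → |t - z| < η → c * |t - z| ^ n ≤ A t ^ 3 - B t ^ 2)
    (hN : ∀ t ∈ Icc 0 T, t ≠ z → |t - z| < η →
      c ≤ |t - z| ^ 3 * (numerator (A t) (B t) (d t) / (108 * (A t ^ 3 - B t ^ 2)))) : False := by
  obtain ⟨K, hK0, hK⟩ := exists_root_bound hA hA0 hAB
  set c' := 3 * c / K ^ 4 with hc'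
  have hc'0 : 0 < c' := by positivity
  set c₂ := √(c / 8) / (3 * (8 + 6 * K)) with hc₂
  have hc₂0 : 0 < c₂ := by positivity
  have hlim : Tendsto (fun Y : ℝ => Y⁻¹) atTop (𝓝 0) := tendsto_inv_atTop_zero
  have hlim1 : Tendsto (fun Y : ℝ => 4 * Y⁻¹ ^ 2) atTop (𝓝 (4 * 0 ^ 2)) :=
    (hlim.pow 2).const_mul 4
  have hlim2 : Tendsto (fun Y : ℝ => c' * Y⁻¹ ^ (2 * n)) atTop (𝓝 (c' * 0 ^ (2 * n))) :=
    (hlim.pow _).const_mul c'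
  rw [zero_pow two_ne_zero, mul_zero] at hlim1
  rw [zero_pow (by omega), mul_zero] at hlim2
  refine not_eventually_le_log (C := C) (L := Real.log (1 + 1 / c')) hc₂0 (2 * n) ?_
  filter_upwards [hlim1.eventually_lt_const hT, hlim1.eventually_lt_const hη,
    hlim2.eventually_lt_const one_pos, hlim2.eventually_lt_const (inv_pos.mpr hR),
    eventually_ge_atTop 1] with Y h1 h2 h3 h4 hY
  have hY0 : 0 < Y := by linarith
  set y := Y⁻¹ with hy
  have hy0 : 0 < y := inv_pos.mpr hY0
  set w := c' * y ^ (2 * n) with hw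
  have hw0 : 0 < w := by positivity
  have hwabs : |w⁻¹| = w⁻¹ := abs_of_pos (inv_pos.mpr hw0)
  have hξ : R ≤ |w⁻¹| := by
    rw [hwabs, le_inv_comm₀ hR hw0]; exact h4.le
  obtain ⟨hint, hle⟩ := hlog w⁻¹ hξ
  have he : 1 / w⁻¹ ^ 2 = w ^ 2 := by field_simp
  rw [he] at hint hle
  rw [hwabs] at hle
  have he0 : 0 < w ^ 2 := by positivity
  have he1 : w ^ 2 ≤ 1 := by nlinarith
  obtain ⟨p, q, hp, hpq, hq, hlen, hJ⟩ := exists_subinterval hz (sq_nonneg y) h1.le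
  have hlow : ∀ t ∈ Icc p q, c₂ / y ^ 3 ≤ perturbedResidue A B d (w ^ 2) t := by
    intro t ht
    have htT : t ∈ Icc 0 T := ⟨hp.trans ht.1, ht.2.trans hq⟩
    obtain ⟨hl, hu⟩ := hJ t ht
    have hy2 : 0 < y ^ 2 := by positivity
    have hpos : 0 < |t - z| := hy2.trans_le hl
    have htz : t ≠ z := sub_ne_zero.mp (abs_pos.mp hpos)
    have hlt : |t - z| < η := by linarith
    have hs := isRootTriple_cubicRoot (hA0 t htT) (hAB t htT)
    have hDt := hDlow t htT htz hlt
    have hDpos : 0 < A t ^ 3 - B t ^ 2 := lt_of_lt_of_le (by positivity) hDt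
    have hwD : ∀ k, √(w ^ 2) ≤ |3 * (cubicRoot (A t) (B t) k ^ 2 - A t)| := by
      intro k
      rw [Real.sqrt_sq hw0.le]
      have h5 := hs.discr_le_deriv (hA0 t htT) (hK t htT).1 (hK t htT).2 k
      have h6 : K ^ 4 * w = 3 * (c * (y ^ 2) ^ n) := by
        rw [hw, hc', pow_mul]; field_simp
      have h7 : c * (y ^ 2) ^ n ≤ c * |t - z| ^ n := by gcongr
      refine le_of_mul_le_mul_left ?_ (by positivity : 0 < K ^ 4)
      linarith
    have h8 := residueSum_le_perturbed (d t) (hA0 t htT) (hAB t htT) (hK t htT).2 he0 he1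
      (isRootTriple_perturbed (hA0 t htT) (hAB t htT) he0.le) hs hwD
    have h9 : √(c / 8) / y ^ 3 ≤ residueSum (d t) (A t) (cubicRoot (A t) (B t)) := by
      refine le_residueSum_of_sq_le hs hDpos.ne' ?_
      have h10 := hN t htT htz hlt
      set N := numerator (A t) (B t) (d t) / (108 * (A t ^ 3 - B t ^ 2))
      have hN0 : 0 < N := by
        by_contra! hneg
        have := mul_nonpos_of_nonneg_of_nonpos (by positivity : 0 ≤ |t - z| ^ 3) hneg
        linarith
      rw [div_pow, Real.sq_sqrt (by positivity), div_le_iff₀ (by positivity)]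
      have h11 : |t - z| ^ 3 ≤ (2 * y ^ 2) ^ 3 := by gcongr
      nlinarith [mul_le_mul_of_nonneg_right h11 hN0.le]
    rw [hc₂, div_right_comm, div_le_iff₀ (by positivity)]
    have h12 := h9.trans h8
    unfold perturbedResidue
    linarith
  have hnonneg : ∀ t, 0 ≤ perturbedResidue A B d (w ^ 2) t := fun t => residueSum_nonneg _ _ _
  have hint' : IntervalIntegrable (perturbedResidue A B d (w ^ 2)) volume p q := by
    refine hint.mono_set ?_
    rw [uIcc_of_le hpq, uIcc_of_le hT.le]
    exact Icc_subset_Icc hp hq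
  have hchain : c₂ * Y ≤ C * Real.log (1 + w⁻¹) := by
    calc c₂ * Y = ∫ _ in p..q, c₂ / y ^ 3 := by
          rw [intervalIntegral.integral_const, hlen, smul_eq_mul, hy]; field_simp
      _ ≤ ∫ t in p..q, perturbedResidue A B d (w ^ 2) t :=
          intervalIntegral.integral_mono_on hpq intervalIntegrable_const hint' hlow
      _ ≤ ∫ t in (0 : ℝ)..T, perturbedResidue A B d (w ^ 2) t :=
          intervalIntegral.integral_mono_interval hp hpq hq
            (Eventually.of_forall hnonneg) hint
      _ ≤ _ := hle
  refine hchain.trans ?_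
  gcongr
  have h13 : 1 + w⁻¹ ≤ (1 + 1 / c') * Y ^ (2 * n) := by
    have : w⁻¹ = 1 / c' * Y ^ (2 * n) := by
      rw [hw, hy, inv_pow]; field_simp
    rw [this]
    have := one_le_pow₀ hY (n := 2 * n)
    linarith
  have h14 := Real.log_le_log (by positivity) h13
  rw [Real.log_mul (by positivity) (by positivity), Real.log_pow] at h14
  exact h14

theorem analyticAt_numerator {z : ℝ} (hA : AnalyticAt ℝ A z) (hB : AnalyticAt ℝ B z)
    (hd : ∀ j, AnalyticAt ℝ (fun t => d t j) z) :
    AnalyticAt ℝ (fun t => numerator (A t) (B t) (d t)) z := by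
  have hre : ∀ j, AnalyticAt ℝ (fun t => (d t j).re) z := fun j =>
    (Complex.reCLM.analyticAt _).comp (hd j)
  have him : ∀ j, AnalyticAt ℝ (fun t => (d t j).im) z := fun j =>
    (Complex.imCLM.analyticAt _).comp (hd j)
  have r0 := hre 0
  have r1 := hre 1
  have r2 := hre 2
  have i0 := him 0
  have i1 := him 1
  have i2 := him 2
  unfold numerator realNumerator
  fun_prop

theorem eventually_residues_le {R : ℝ} (hT : 0 < T) (hR : 0 < R)
    (hA : AnalyticOnNhd ℝ A (Icc 0 T)) (hB : AnalyticOnNhd ℝ B (Icc 0 T))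
    (hd : ∀ j, AnalyticOnNhd ℝ (fun t => d t j) (Icc 0 T))
    (hA0 : ∀ t ∈ Icc 0 T, 0 ≤ A t) (hAB : ∀ t ∈ Icc 0 T, B t ^ 2 ≤ A t ^ 3)
    {C : ℝ} (hC : 0 ≤ C) (hlog : ∀ ξ : ℝ, R ≤ |ξ| →
      IntervalIntegrable (perturbedResidue A B d (1 / ξ ^ 2)) volume 0 T ∧
      ∫ t in (0 : ℝ)..T, perturbedResidue A B d (1 / ξ ^ 2) t ≤ C * Real.log (1 + |ξ|))
    {z : ℝ} (hz : z ∈ Icc 0 T) (hD : ¬ ∀ᶠ t in 𝓝 z, A t ^ 3 - B t ^ 2 = 0) :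
    ∃ M, ∀ᶠ t in 𝓝[Icc 0 T] z, t ≠ z →
      (t - z) ^ 2 * (numerator (A t) (B t) (d t) / (108 * (A t ^ 3 - B t ^ 2))) ≤ M := by
  have hDan : AnalyticAt ℝ (fun t => A t ^ 3 - B t ^ 2) z :=
    ((hA z hz).pow 3).sub ((hB z hz).pow 2)
  have hPan := analyticAt_numerator (hA z hz) (hB z hz) fun j => hd j z hz
  obtain ⟨n, u, hu, hu0, hDu⟩ := hDan.exists_eventuallyEq_pow_smul_nonzero_iff.mpr hD
  by_cases hP : ∀ᶠ t in 𝓝 z, numerator (A t) (B t) (d t) = 0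
  · refine ⟨0, ?_⟩
    filter_upwards [nhdsWithin_le_nhds hP] with t ht _
    simp [ht]
  obtain ⟨k, v, hv, hv0, hPv⟩ := hPan.exists_eventuallyEq_pow_smul_nonzero_iff.mpr hP
  have hune : ∀ᶠ t in 𝓝 z, u t ≠ 0 := hu.continuousAt.eventually_ne hu0
  have hq : ContinuousAt (fun t => v t / (108 * u t)) z :=
    hv.continuousAt.div (hu.continuousAt.const_mul 108) (by positivity)
  rcases le_or_gt n (k + 2) with hnk | hnk
  · obtain ⟨m, hm⟩ := Nat.exists_eq_add_of_le hnk
    have hcont : ContinuousAt (fun t => (t - z) ^ m * (v t / (108 * u t))) z :=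
      ContinuousAt.mul (by fun_prop) hq
    refine ⟨(z - z) ^ m * (v z / (108 * u z)) + 1, ?_⟩
    filter_upwards [nhdsWithin_le_nhds (hcont.eventually_lt_const (lt_add_one _)),
      nhdsWithin_le_nhds hDu, nhdsWithin_le_nhds hPv, nhdsWithin_le_nhds hune]
      with t h1 h2 h3 h4 htz
    refine le_trans (le_of_eq ?_) h1.le
    have h5 : t - z ≠ 0 := sub_ne_zero.mpr htz
    rw [h2, h3, smul_eq_mul, smul_eq_mul]
    have h6 : (t - z) ^ k * (t - z) ^ 2 = (t - z) ^ n * (t - z) ^ m := by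
      rw [← pow_add, ← pow_add, hm]
    field_simp
    linear_combination v t * h6
  · exfalso
    obtain ⟨m, hm⟩ := Nat.exists_eq_add_of_lt hnk
    set c := min (|u z| / 2) (|v z / (108 * u z)| / 2) with hc
    have hu0' : 0 < |u z| := abs_pos.mpr hu0
    have hq0' : 0 < |v z / (108 * u z)| := abs_pos.mpr (by positivity)
    have hc0 : 0 < c := lt_min (by positivity) (by positivity)
    have e1 : ∀ᶠ t in 𝓝 z, c < |u t| := hu.continuousAt.abs.eventually_const_lt
      ((min_le_left _ _).trans_lt (by linarith))
    have e2 : ∀ᶠ t in 𝓝 z, c < |v t / (108 * u t)| := hq.abs.eventually_const_lt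
      ((min_le_right _ _).trans_lt (by linarith))
    obtain ⟨η, hη, hall⟩ := Metric.eventually_nhds_iff.mp
      (hDu.and (hPv.and (e1.and (e2.and hune))))
    refine not_log_of_strong_singularity (c := c) (η := min η 1) (n := n) hT hR
      hA.continuousOn hA0 hAB hC hlog
      (by omega) hz hc0 (lt_min hη one_pos) ?_ ?_
    · intro t ht htz hlt
      obtain ⟨h1, -, h2, -, -⟩ := hall (y := t) (by
        rw [Real.dist_eq]; exact hlt.trans_le (min_le_left _ _))
      rw [← abs_of_nonneg (sub_nonneg.mpr (hAB t ht)), h1, smul_eq_mul, abs_mul, abs_pow, mul_comm]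
      gcongr
    · intro t ht htz hlt
      obtain ⟨h1, h2, h3, h4, h5⟩ := hall (y := t) (by
        rw [Real.dist_eq]; exact hlt.trans_le (min_le_left _ _))
      have h6 : t - z ≠ 0 := sub_ne_zero.mpr htz
      have hN0 : 0 ≤ numerator (A t) (B t) (d t) / (108 * (A t ^ 3 - B t ^ 2)) := by
        have h7 : A t ^ 3 - B t ^ 2 ≠ 0 := by
          rw [h1, smul_eq_mul]; positivity
        rw [← sum_sq_residue_eq _ (isRootTriple_cubicRoot (hA0 t ht) (hAB t ht)) h7]
        positivity
      rw [← abs_of_nonneg hN0, h1, h2, smul_eq_mul, smul_eq_mul]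
      have h8 : (t - z) ^ k * v t / (108 * ((t - z) ^ n * u t)) =
          v t / (108 * u t) / (t - z) ^ (3 + m) := by
        rw [hm]; field_simp; ring
      have h9 : |t - z| ≤ 1 := (hlt.trans_le (min_le_right _ _)).le
      have h10 : 0 < |t - z| := abs_pos.mpr h6
      rw [h8, abs_div, abs_pow, mul_div_assoc', le_div_iff₀ (by positivity), pow_add, mul_left_comm]
      gcongr
      calc c * |t - z| ^ m ≤ c * 1 := by gcongr; exact pow_le_one₀ h10.le h9
        _ ≤ _ := by linarith

theorem exists_pointwise_bound {R : ℝ} (hT : 0 < T) (hR : 0 < R)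
    (hA : AnalyticOnNhd ℝ A (Icc 0 T)) (hB : AnalyticOnNhd ℝ B (Icc 0 T))
    (hd : ∀ j, AnalyticOnNhd ℝ (fun t => d t j) (Icc 0 T))
    (hA0 : ∀ t ∈ Icc 0 T, 0 ≤ A t) (hAB : ∀ t ∈ Icc 0 T, B t ^ 2 ≤ A t ^ 3)
    (hfin : {t ∈ Icc 0 T | A t ^ 3 - B t ^ 2 = 0}.Finite)
    {C : ℝ} (hC : 0 ≤ C) (hlog : ∀ ξ : ℝ, R ≤ |ξ| →
      IntervalIntegrable (perturbedResidue A B d (1 / ξ ^ 2)) volume 0 T ∧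
      ∫ t in (0 : ℝ)..T, perturbedResidue A B d (1 / ξ ^ 2) t ≤ C * Real.log (1 + |ξ|)) :
    ∃ K > 0, ∀ t ∈ Icc 0 T, ∀ k, (∏ s ∈ hfin.toFinset, |t - s|) *
      ‖quad (d t) (cubicRoot (A t) (B t) k)‖ ≤
        K * |3 * (cubicRoot (A t) (B t) k ^ 2 - A t)| := by
  set N := fun t => numerator (A t) (B t) (d t) / (108 * (A t ^ 3 - B t ^ 2)) with hN
  set Z := hfin.toFinset with hZ
  have hmem : ∀ t, t ∈ Z ↔ t ∈ Icc 0 T ∧ A t ^ 3 - B t ^ 2 = 0 := fun t => by simp [hZ]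
  have hDne : ∀ z ∈ Icc 0 T, ¬ ∀ᶠ t in 𝓝 z, A t ^ 3 - B t ^ 2 = 0 := by
    intro z hz h
    obtain ⟨η, hη, hall⟩ := Metric.eventually_nhds_iff.mp h
    obtain ⟨x, hx0, hxT, hxη⟩ : ∃ x, 0 < x ∧ 4 * x ≤ T ∧ 2 * x < η :=
      ⟨min (T / 4) (η / 4), by positivity, by linarith [min_le_left (T / 4) (η / 4)],
        by linarith [min_le_right (T / 4) (η / 4)]⟩
    obtain ⟨p, q, hp, -, hq, hlen, hJ⟩ := exists_subinterval hz hx0.le hxT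
    refine (Icc_infinite (by linarith : p < q)) (hfin.subset fun t ht => ?_)
    exact ⟨⟨hp.trans ht.1, ht.2.trans hq⟩, hall (by
      rw [Real.dist_eq]; exact (hJ t ht).2.trans_lt hxη)⟩
  have hloc : ∀ z ∈ Icc 0 T, ∃ U ∈ 𝓝[Icc 0 T] z, ∃ M, ∀ t ∈ U, t ∉ Z →
      (∏ s ∈ Z, |t - s|) ^ 2 * N t ≤ M := by
    intro z hz
    by_cases hzZ : z ∈ Z
    · obtain ⟨M, hM⟩ := eventually_residues_le hT hR hA hB hd hA0 hAB hC hlog hz (hDne z hz)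
      have hcont : Continuous fun t => (∏ s ∈ Z.erase z, |t - s|) ^ 2 := by fun_prop
      have h2 := hcont.continuousAt.eventually_lt_const
        (lt_add_one ((∏ s ∈ Z.erase z, |z - s|) ^ 2))
      refine ⟨_, hM.and (nhdsWithin_le_nhds h2),
        ((∏ s ∈ Z.erase z, |z - s|) ^ 2 + 1) * |M|, fun t ht htZ => ?_⟩
      obtain ⟨h3, h4⟩ := ht
      have h5 := h3 fun h => htZ (h ▸ hzZ)
      rw [← Finset.mul_prod_erase Z _ hzZ, mul_pow, sq_abs, mul_right_comm, mul_comm]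
      exact (mul_le_mul_of_nonneg_left (h5.trans (le_abs_self M)) (sq_nonneg _)).trans
        (mul_le_mul_of_nonneg_right h4.le (abs_nonneg M))
    · have hD0 : A z ^ 3 - B z ^ 2 ≠ 0 := fun h => hzZ ((hmem z).mpr ⟨hz, h⟩)
      have hcont : ContinuousAt (fun t => (∏ s ∈ Z, |t - s|) ^ 2 * N t) z := by
        refine ContinuousAt.mul (by fun_prop) (ContinuousAt.div
          (analyticAt_numerator (hA z hz) (hB z hz) fun j => hd j z hz).continuousAt
          ((((hA z hz).continuousAt.pow 3).sub ((hB z hz).continuousAt.pow 2)).const_mul 108) ?_)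
        positivity
      exact ⟨_, nhdsWithin_le_nhds (hcont.eventually_lt_const (lt_add_one _)), _,
        fun t ht _ => le_of_lt ht⟩
  obtain ⟨M, hM⟩ : ∃ M, ∀ t ∈ Icc 0 T, t ∉ Z → (∏ s ∈ Z, |t - s|) ^ 2 * N t ≤ M := by
    refine isCompact_Icc.induction_on (p := fun U => ∃ M, ∀ t ∈ U, t ∉ Z →
      (∏ s ∈ Z, |t - s|) ^ 2 * N t ≤ M) ⟨0, by simp⟩ ?_ ?_ ?_
    · rintro U V hUV ⟨M, hM⟩
      exact ⟨M, fun t ht => hM t (hUV ht)⟩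
    · rintro U V ⟨M, hM⟩ ⟨M', hM'⟩
      refine ⟨max M M', fun t ht htZ => ?_⟩
      rcases ht with ht | ht
      · exact (hM t ht htZ).trans (le_max_left _ _)
      · exact (hM' t ht htZ).trans (le_max_right _ _)
    · exact hloc
  refine ⟨√|M| + 1, by positivity, fun t ht k => ?_⟩
  by_cases htZ : t ∈ Z
  · rw [Finset.prod_eq_zero htZ (by simp), zero_mul]
    positivity
  · have hD0 : A t ^ 3 - B t ^ 2 ≠ 0 := fun h => htZ ((hmem t).mpr ⟨ht, h⟩)
    have hs := isRootTriple_cubicRoot (hA0 t ht) (hAB t ht)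
    have hq := abs_pos.mpr (hs.deriv_ne_zero hD0 k)
    rw [← div_le_iff₀ hq, mul_div_assoc]
    have h1 : (‖quad (d t) (cubicRoot (A t) (B t) k)‖ /
        |3 * (cubicRoot (A t) (B t) k ^ 2 - A t)|) ^ 2 ≤ N t := by
      simp only [hN]
      rw [← sum_sq_residue_eq (d t) hs hD0]
      exact Finset.single_le_sum (f := fun k => (‖quad (d t) (cubicRoot (A t) (B t) k)‖ /
        |3 * (cubicRoot (A t) (B t) k ^ 2 - A t)|) ^ 2) (fun _ _ => sq_nonneg _)
        (Finset.mem_univ k)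
    have h2 := mul_le_mul_of_nonneg_left h1 (sq_nonneg (∏ s ∈ Z, |t - s|))
    rw [← mul_pow] at h2
    have h3 := Real.abs_le_sqrt ((h2.trans (hM t ht htZ)).trans (le_abs_self M))
    linarith [le_of_abs_le h3]

end

/-- The monic cubic polynomial with roots `y`. -/
noncomputable def cubicOfRoots (y : Fin 3 → ℝ) : ℝ[X] :=
  (X - C (y 0)) * (X - C (y 1)) * (X - C (y 2))

theorem cubicOfRoots_eq_prod (y : Fin 3 → ℝ) : cubicOfRoots y =
    (Multiset.map (fun r => X - C r) ({y 0, y 1, y 2} : Multiset ℝ)).prod := by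
  simp [cubicOfRoots, mul_assoc]

theorem roots_cubicOfRoots (y : Fin 3 → ℝ) : (cubicOfRoots y).roots = {y 0, y 1, y 2} := by
  rw [cubicOfRoots_eq_prod, roots_multiset_prod_X_sub_C]

theorem eval_derivative_cubicOfRoots (y : Fin 3 → ℝ) (r : ℝ) :
    (derivative (cubicOfRoots y)).eval r =
      (r - y 0) * (r - y 1) + (r - y 1) * (r - y 2) + (r - y 2) * (r - y 0) := by
  simp [cubicOfRoots]; ring

theorem orderedRoot_eq_roots {p : ℝ[X]} (hp : p.roots.card = 3) :
    ({orderedRoot p 0, orderedRoot p 1, orderedRoot p 2} : Multiset ℝ) = p.roots := by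
  have hl : (p.roots.sort (· ≤ ·)).length = 3 := by simp [hp]
  obtain ⟨x, y, z, h⟩ := List.length_eq_three.mp hl
  have := Multiset.sort_eq p.roots (· ≤ ·)
  rw [← this]
  simp only [orderedRoot, h]
  rfl

theorem eq_cubicOfRoots_orderedRoot {p : ℝ[X]} (hm : p.Monic) (hd : p.natDegree = 3)
    (hp : p.roots.card = 3) : p = cubicOfRoots fun j : Fin 3 => orderedRoot p j := by
  have h := prod_multiset_X_sub_C_of_monic_of_roots_card_eq hm (hp.trans hd.symm)
  rw [← orderedRoot_eq_roots hp] at h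
  exact h.symm.trans (cubicOfRoots_eq_prod fun j : Fin 3 => orderedRoot p j).symm

theorem orderedRoot_cubicOfRoots (y : Fin 3 → ℝ) :
    ({orderedRoot (cubicOfRoots y) 0, orderedRoot (cubicOfRoots y) 1,
      orderedRoot (cubicOfRoots y) 2} : Multiset ℝ) = {y 0, y 1, y 2} := by
  rw [orderedRoot_eq_roots, roots_cubicOfRoots]
  rw [roots_cubicOfRoots]; rfl

theorem cubicOfRoots_orderedRoot (y : Fin 3 → ℝ) :
    (cubicOfRoots fun j : Fin 3 => orderedRoot (cubicOfRoots y) j) = cubicOfRoots y := by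
  have h := congrArg (fun s : Multiset ℝ => (s.map fun r => X - C r).prod)
    (orderedRoot_cubicOfRoots y)
  exact (cubicOfRoots_eq_prod _).trans (h.trans (cubicOfRoots_eq_prod y).symm)

theorem gap_eq_abs_derivative (y : Fin 3 → ℝ) :
    ∀ i ∈ S3, |y i.1 - y i.2.1| * |y i.1 - y i.2.2| =
      |(derivative (cubicOfRoots y)).eval (y i.1)| := by
  intro i hi
  rw [eval_derivative_cubicOfRoots, ← abs_mul]
  simp only [S3, Finset.mem_insert, Finset.mem_singleton] at hi
  rcases hi with rfl | rfl | rfl <;> simp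

theorem sum_S3 (g : Fin 3 → ℝ) : ∑ i ∈ S3, g i.1 = ∑ k, g k := by
  rw [S3, Fin.sum_univ_three, Finset.sum_insert (by decide), Finset.sum_insert (by decide),
    Finset.sum_singleton, add_assoc]

theorem forall_S3 (q : Fin 3 → Prop) : (∀ i ∈ S3, q i.1) ↔ ∀ k, q k := by
  simp [S3, Fin.forall_fin_succ]

theorem sum_S3_orderedRoot (y : Fin 3 → ℝ) (f : ℝ → ℝ) :
    ∑ i ∈ S3, f (orderedRoot (cubicOfRoots y) i.1) /
      (|orderedRoot (cubicOfRoots y) i.1 - orderedRoot (cubicOfRoots y) i.2.1| *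
        |orderedRoot (cubicOfRoots y) i.1 - orderedRoot (cubicOfRoots y) i.2.2|) =
    ∑ k, f (y k) / |(derivative (cubicOfRoots y)).eval (y k)| := by
  set r := fun j : Fin 3 => orderedRoot (cubicOfRoots y) j with hr
  have hgap := gap_eq_abs_derivative r
  rw [cubicOfRoots_orderedRoot y] at hgap
  have h1 : ∀ i ∈ S3, f (r i.1) / (|r i.1 - r i.2.1| * |r i.1 - r i.2.2|) =
      f (r i.1) / |(derivative (cubicOfRoots y)).eval (r i.1)| := fun i hi => by rw [hgap i hi]
  refine (Finset.sum_congr rfl h1).trans ?_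
  rw [sum_S3 fun k => f (r k) / |(derivative (cubicOfRoots y)).eval (r k)|]
  have h0 : ({r 0, r 1, r 2} : Multiset ℝ) = {y 0, y 1, y 2} := orderedRoot_cubicOfRoots y
  have h2 := congrArg (fun s : Multiset ℝ =>
    (s.map fun x => f x / |(derivative (cubicOfRoots y)).eval x|).sum) h0
  rw [Fin.sum_univ_three, Fin.sum_univ_three]
  simpa [add_assoc] using h2

theorem forall_S3_orderedRoot (y : Fin 3 → ℝ) (f : ℝ → ℝ) (K : ℝ) :
    (∀ i ∈ S3, f (orderedRoot (cubicOfRoots y) i.1) ≤ K *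
      (|orderedRoot (cubicOfRoots y) i.1 - orderedRoot (cubicOfRoots y) i.2.1| *
        |orderedRoot (cubicOfRoots y) i.1 - orderedRoot (cubicOfRoots y) i.2.2|)) ↔
    ∀ k, f (y k) ≤ K * |(derivative (cubicOfRoots y)).eval (y k)| := by
  set r := fun j : Fin 3 => orderedRoot (cubicOfRoots y) j with hr
  have hgap := gap_eq_abs_derivative r
  rw [cubicOfRoots_orderedRoot y] at hgap
  have h1 : (∀ i ∈ S3, f (r i.1) ≤ K * (|r i.1 - r i.2.1| * |r i.1 - r i.2.2|)) ↔
      ∀ i ∈ S3, f (r i.1) ≤ K * |(derivative (cubicOfRoots y)).eval (r i.1)| :=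
    forall₂_congr fun i hi => by rw [hgap i hi]
  refine h1.trans ?_
  rw [forall_S3 fun k => f (r k) ≤ K * |(derivative (cubicOfRoots y)).eval (r k)|]
  have h2 : ∀ q : ℝ → Prop, (∀ k, q (r k)) ↔ ∀ k, q (y k) := by
    intro q
    have h3 : (∀ x ∈ ({r 0, r 1, r 2} : Multiset ℝ), q x) ↔
        ∀ x ∈ ({y 0, y 1, y 2} : Multiset ℝ), q x := by
      rw [show ({r 0, r 1, r 2} : Multiset ℝ) = {y 0, y 1, y 2} from orderedRoot_cubicOfRoots y]
    simpa [Fin.forall_fin_succ] using h3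
  exact h2 fun x => f x ≤ K * |(derivative (cubicOfRoots y)).eval x|

variable (a : Fin 3 → ℝ → ℝ) (b : Fin 3 → ℝ → ℂ)

/-- The linear coefficient, divided by `-3`, of the depressed characteristic cubic. -/
noncomputable def depressedA (t : ℝ) : ℝ := a 2 t ^ 2 / 9 - a 1 t / 3

/-- The constant coefficient, divided by `-2`, of the depressed characteristic cubic. -/
noncomputable def depressedB (t : ℝ) : ℝ := a 1 t * a 2 t / 6 - a 2 t ^ 3 / 27 - a 0 t / 2

/-- The coefficients of the subprincipal symbol in the variable of the depressed cubic. -/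
noncomputable def depressedCoeff (t : ℝ) : Fin 3 → ℂ :=
  ![b 0 t - (deriv (a 1) t / 2 : ℝ) - (a 2 t / 3 : ℝ) * (b 1 t - (deriv (a 2) t : ℝ)) +
      (a 2 t / 3 : ℝ) ^ 2 * b 2 t,
    b 1 t - (deriv (a 2) t : ℝ) - 2 * (a 2 t / 3 : ℝ) * b 2 t, b 2 t]

theorem symbolL_eq (t ξ : ℝ) : symbolL a t ξ =
    X ^ 3 + C (a 2 t * ξ) * X ^ 2 + C (a 1 t * ξ ^ 2) * X + C (a 0 t * ξ ^ 3) := by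
  simp [symbolL, Fin.sum_univ_three]; ring

theorem natDegree_symbolL (t ξ : ℝ) : (symbolL a t ξ).natDegree = 3 := by
  rw [symbolL_eq]; compute_degree!

theorem monic_symbolL (t ξ : ℝ) : (symbolL a t ξ).Monic := by
  rw [symbolL_eq]; monicity!

theorem eval_derivative_symbolL (t ξ τ : ℝ) : (derivative (symbolL a t ξ)).eval τ =
    3 * τ ^ 2 + 2 * (a 2 t * ξ) * τ + a 1 t * ξ ^ 2 := by
  rw [symbolL_eq]
  simp only [derivative_add, derivative_mul, derivative_C, derivative_X_pow, derivative_X,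
    eval_add, eval_mul, eval_pow, eval_X, eval_C, eval_zero]
  simp
  ring

theorem checkM_eq {t : ℝ} (h1 : DifferentiableAt ℝ (a 1) t) (h2 : DifferentiableAt ℝ (a 2) t)
    (x ξ : ℝ) :
    checkM a b t (ξ * (x - a 2 t / 3)) ξ = (ξ : ℂ) ^ 2 * quad (depressedCoeff a b t) x := by
  have hd : ∀ τ, deriv (fun s => (derivative (symbolL a s ξ)).eval τ) t =
      2 * (deriv (a 2) t * ξ) * τ + deriv (a 1) t * ξ ^ 2 := by
    intro τ
    simp only [eval_derivative_symbolL]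
    exact ((((h2.hasDerivAt.mul_const ξ).const_mul 2).mul_const τ).const_add (3 * τ ^ 2)).add
      (h1.hasDerivAt.mul_const (ξ ^ 2)) |>.deriv
  rw [checkM, hd]
  simp [symbolM, quad, depressedCoeff, Fin.sum_univ_three]
  ring

theorem symbolL_eq_cubicOfRoots {t : ℝ} {x : Fin 3 → ℝ}
    (hx : IsRootTriple (depressedA a t) (depressedB a t) x) (ξ : ℝ) :
    symbolL a t ξ = cubicOfRoots fun k => ξ * (x k - a 2 t / 3) := by
  obtain ⟨h1, h2, h3⟩ := hx
  rw [depressedA] at h2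
  rw [depressedB] at h3
  refine Polynomial.funext fun r => ?_
  simp only [symbolL_eq, cubicOfRoots, eval_add, eval_mul, eval_pow, eval_X, eval_C, eval_sub]
  linear_combination ξ * (r + ξ * a 2 t / 3) ^ 2 * h1 - ξ ^ 2 * (r + ξ * a 2 t / 3) * h2 +
    ξ ^ 3 * h3

theorem auxL_eq_cubicOfRoots {t ξ : ℝ} (hξ : ξ ≠ 0) {x : Fin 3 → ℝ}
    (hx : IsRootTriple (depressedA a t + 2 * (1 / ξ ^ 2)) (depressedB a t) x) :
    auxL a t ξ = cubicOfRoots fun k => ξ * (x k - a 2 t / 3) := by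
  obtain ⟨h1, h2, h3⟩ := hx
  rw [depressedA] at h2
  rw [depressedB] at h3
  have h4 : ξ ^ 2 * (1 / ξ ^ 2) = 1 := by field_simp
  refine Polynomial.funext fun r => ?_
  simp only [auxL, symbolL_eq, cubicOfRoots, eval_add, eval_mul, eval_pow, eval_X, eval_C,
    eval_sub, derivative_add, derivative_mul, derivative_C, derivative_X_pow, derivative_X]
  simp
  linear_combination ξ * (r + ξ * a 2 t / 3) ^ 2 * h1 - ξ ^ 2 * (r + ξ * a 2 t / 3) * h2 +
    ξ ^ 3 * h3 + 6 * (r + ξ * a 2 t / 3) * h4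

theorem isRootTriple_of_symbolL_eq {t ξ : ℝ} {r : Fin 3 → ℝ}
    (h : symbolL a t ξ = cubicOfRoots r) :
    IsRootTriple (ξ ^ 2 * depressedA a t) (ξ ^ 3 * depressedB a t)
      fun k => r k + ξ * (a 2 t / 3) := by
  have he : ∀ s, s ^ 3 + a 2 t * ξ * s ^ 2 + a 1 t * ξ ^ 2 * s + a 0 t * ξ ^ 3 =
      (s - r 0) * (s - r 1) * (s - r 2) := by
    intro s
    have := congrArg (eval s) h
    simpa [symbolL_eq, cubicOfRoots] using this
  have e0 := he 0
  have e1 := he 1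
  have e2 := he (-1)
  have c2 : r 0 + r 1 + r 2 = -(a 2 t * ξ) := by
    linear_combination (e1 + e2) / 2 - e0
  have c1 : r 0 * r 1 + r 1 * r 2 + r 2 * r 0 = a 1 t * ξ ^ 2 := by
    linear_combination (e2 - e1) / 2
  have c0 : r 0 * r 1 * r 2 = -(a 0 t * ξ ^ 3) := by
    linear_combination e0
  constructor
  · linear_combination c2
  · rw [depressedA]
    linear_combination c1 + 2 * (ξ * (a 2 t / 3)) * c2
  · rw [depressedB]
    linear_combination c0 + (ξ * (a 2 t / 3)) * c1 + (ξ * (a 2 t / 3)) ^ 2 * c2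

theorem symbolL_eq_orderedRoot {t ξ : ℝ} (h : (symbolL a t ξ).Splits) :
    symbolL a t ξ = cubicOfRoots fun j => tauRoot a j t ξ :=
  eq_cubicOfRoots_orderedRoot (monic_symbolL a t ξ) (natDegree_symbolL a t ξ)
    (h.natDegree_eq_card_roots.symm.trans (natDegree_symbolL a t ξ))

theorem depressed_nonneg {t : ℝ} (h : (symbolL a t 1).Splits) :
    0 ≤ depressedA a t ∧ depressedB a t ^ 2 ≤ depressedA a t ^ 3 := by
  have hr := isRootTriple_of_symbolL_eq a (symbolL_eq_orderedRoot a h)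
  simp only [one_pow, one_mul] at hr
  constructor
  · have := hr.sq_sum
    nlinarith [sq_nonneg (tauRoot a 0 t 1 + a 2 t / 3), sq_nonneg (tauRoot a 1 t 1 + a 2 t / 3),
      sq_nonneg (tauRoot a 2 t 1 + a 2 t / 3)]
  · have h1 := hr.discr
    have h2 : 0 ≤ 108 * (depressedA a t ^ 3 - depressedB a t ^ 2) := by
      rw [← h1]; positivity
    linarith

theorem discrL_eq {t ξ : ℝ} (h : (symbolL a t ξ).Splits) :
    discrL a t ξ = 108 * ξ ^ 6 * (depressedA a t ^ 3 - depressedB a t ^ 2) := by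
  have hr := (isRootTriple_of_symbolL_eq a (symbolL_eq_orderedRoot a h)).discr
  rw [discrL]
  linear_combination hr

theorem abs_derivative_scaled {A B : ℝ} {x : Fin 3 → ℝ} (hx : IsRootTriple A B x) (α ξ : ℝ)
    (k : Fin 3) :
    |(derivative (cubicOfRoots fun k => ξ * (x k - α))).eval (ξ * (x k - α))| =
      ξ ^ 2 * |3 * (x k ^ 2 - A)| := by
  have : (derivative (cubicOfRoots fun k => ξ * (x k - α))).eval (ξ * (x k - α)) =
      ξ ^ 2 * (3 * (x k ^ 2 - A)) := by
    rw [eval_derivative_cubicOfRoots]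
    linear_combination ξ ^ 2 * hx.pairs - 2 * ξ ^ 2 * x k * hx.sum
  rw [this, abs_mul, abs_of_nonneg (sq_nonneg ξ)]

theorem norm_checkM_eq {t : ℝ} (h1 : DifferentiableAt ℝ (a 1) t) (h2 : DifferentiableAt ℝ (a 2) t)
    (x ξ : ℝ) : ‖checkM a b t (ξ * (x - a 2 t / 3)) ξ‖ =
      ξ ^ 2 * ‖quad (depressedCoeff a b t) x‖ := by
  rw [checkM_eq a b h1 h2, norm_mul, norm_pow, Complex.norm_real, Real.norm_eq_abs, sq_abs]

theorem leviIntegrand_eq {t ξ : ℝ} (hξ : ξ ≠ 0) (h1 : DifferentiableAt ℝ (a 1) t)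
    (h2 : DifferentiableAt ℝ (a 2) t) (hs : (symbolL a t 1).Splits) :
    leviIntegrand a b t ξ =
      perturbedResidue (depressedA a) (depressedB a) (depressedCoeff a b) (1 / ξ ^ 2) t := by
  obtain ⟨hA, hB⟩ := depressed_nonneg a hs
  have hx := isRootTriple_perturbed hA hB (by positivity : 0 ≤ 1 / ξ ^ 2)
  have hp := auxL_eq_cubicOfRoots a hξ hx
  have key := sum_S3_orderedRoot (fun k => ξ * (cubicRoot (depressedA a t + 2 * (1 / ξ ^ 2))
    (depressedB a t) k - a 2 t / 3)) (fun τ => ‖checkM a b t τ ξ‖)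
  rw [← hp] at key
  unfold perturbedResidue residueSum
  refine key.trans (Finset.sum_congr rfl fun k _ => ?_)
  rw [hp, abs_derivative_scaled hx, norm_checkM_eq a b h1 h2,
    mul_div_mul_left _ _ (pow_ne_zero 2 hξ)]

theorem pointwise_iff {t : ℝ} (h1 : DifferentiableAt ℝ (a 1) t)
    (h2 : DifferentiableAt ℝ (a 2) t) (hs : (symbolL a t 1).Splits) (c K ξ : ℝ) :
    (∀ i ∈ S3, c * ‖checkM a b t (tauRoot a i.1 t ξ) ξ‖ ≤
      K * (|tauRoot a i.1 t ξ - tauRoot a i.2.1 t ξ| *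
          |tauRoot a i.1 t ξ - tauRoot a i.2.2 t ξ|)) ↔
    ∀ k, ξ ^ 2 * (c *
        ‖quad (depressedCoeff a b t) (cubicRoot (depressedA a t) (depressedB a t) k)‖) ≤
      ξ ^ 2 * (K * |3 * (cubicRoot (depressedA a t) (depressedB a t) k ^ 2 - depressedA a t)|) := by
  obtain ⟨hA, hB⟩ := depressed_nonneg a hs
  have hx := isRootTriple_cubicRoot hA hB
  have hp := symbolL_eq_cubicOfRoots a hx ξ
  have key := forall_S3_orderedRoot (fun k => ξ * (cubicRoot (depressedA a t)
    (depressedB a t) k - a 2 t / 3)) (fun τ => c * ‖checkM a b t τ ξ‖) K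
  rw [← hp] at key
  refine key.trans (forall_congr' fun k => ?_)
  rw [hp, abs_derivative_scaled hx, norm_checkM_eq a b h1 h2, mul_left_comm,
    mul_left_comm K]

theorem finite_zeros {D : ℝ → ℝ} {T : ℝ} (hD : AnalyticOnNhd ℝ D (Icc 0 T))
    (hne : ∃ t ∈ Icc 0 T, D t ≠ 0) : {t ∈ Icc 0 T | D t = 0}.Finite := by
  by_contra hinf
  obtain ⟨z, hz, hacc⟩ := Set.Infinite.exists_accPt_of_subset_isCompact hinf isCompact_Icc
    (sep_subset _ _)
  obtain ⟨t, ht, hDt⟩ := hne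
  refine hDt (hD.eqOn_zero_of_preconnected_of_frequently_eq_zero isPreconnected_Icc hz ?_ ht)
  exact (accPt_iff_frequently_nhdsNE.mp hacc).mono fun s hs => hs.2

end ThirdOrder

open ThirdOrder in
theorem mainTheorem9 (T δ R : ℝ) (hT : 0 < T) (hδ : 0 < δ) (hR : 0 < R)
    (a : Fin 3 → ℝ → ℝ) (b : Fin 3 → ℝ → ℂ)
    (ha : ∀ j, AnalyticOnNhd ℝ (a j) (Set.Ioo (-δ) (T + δ)))
    (hb : ∀ j, AnalyticOnNhd ℝ (b j) (Set.Ioo (-δ) (T + δ)))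
    (hyp : ThirdOrder.WeaklyHyperbolic T a)
    (hdiscr : ∃ t ∈ Set.Icc 0 T, ∃ ξ : ℝ, ThirdOrder.discrL a t ξ ≠ 0) :
    ThirdOrder.LogLevi T R a b ↔ ThirdOrder.PointwiseLevi T δ a b := by
  have hsub : Icc 0 T ⊆ Ioo (-δ) (T + δ) := fun t ht => ⟨by linarith [ht.1], by linarith [ht.2]⟩
  have han : ∀ j, AnalyticOnNhd ℝ (a j) (Icc 0 T) := fun j => (ha j).mono hsub
  have hbn : ∀ j, AnalyticOnNhd ℝ (b j) (Icc 0 T) := fun j => (hb j).mono hsub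
  have hdan : ∀ j, AnalyticOnNhd ℝ (fun t => ((deriv (a j) t : ℝ) : ℂ)) (Icc 0 T) := fun j t ht =>
    (Complex.ofRealCLM.analyticAt _).comp ((han j).deriv t ht)
  have hcan : ∀ j, AnalyticOnNhd ℝ (fun t => ((a j t : ℝ) : ℂ)) (Icc 0 T) := fun j t ht =>
    (Complex.ofRealCLM.analyticAt _).comp (han j t ht)
  have hA : AnalyticOnNhd ℝ (depressedA a) (Icc 0 T) := fun t ht => by
    have h1 := han 1 t ht
    have h2 := han 2 t ht
    unfold depressedA
    fun_prop (disch := norm_num)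
  have hB : AnalyticOnNhd ℝ (depressedB a) (Icc 0 T) := fun t ht => by
    have h0 := han 0 t ht
    have h1 := han 1 t ht
    have h2 := han 2 t ht
    unfold depressedB
    fun_prop (disch := norm_num)
  have hd : ∀ j, AnalyticOnNhd ℝ (fun t => depressedCoeff a b t j) (Icc 0 T) := fun j t ht => by
    have h1 := hdan 1 t ht
    have h2 := hdan 2 t ht
    have h3 := hcan 2 t ht
    have b0 := hbn 0 t ht
    have b1 := hbn 1 t ht
    have b2 := hbn 2 t ht
    fin_cases j <;> simp [depressedCoeff] <;> fun_prop (disch := norm_num)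
  have hs : ∀ t ∈ Icc 0 T, (symbolL a t 1).Splits := fun t ht => hyp t ht 1
  have hA0 : ∀ t ∈ Icc 0 T, 0 ≤ depressedA a t := fun t ht => (depressed_nonneg a (hs t ht)).1
  have hAB : ∀ t ∈ Icc 0 T, depressedB a t ^ 2 ≤ depressedA a t ^ 3 := fun t ht =>
    (depressed_nonneg a (hs t ht)).2
  have hdiff : ∀ j, ∀ t ∈ Icc 0 T, DifferentiableAt ℝ (a j) t := fun j t ht =>
    (han j t ht).differentiableAt
  have hfin : {t ∈ Icc 0 T | depressedA a t ^ 3 - depressedB a t ^ 2 = 0}.Finite := by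
    refine finite_zeros (fun t ht => ((hA t ht).pow 3).sub ((hB t ht).pow 2)) ?_
    obtain ⟨t, ht, ξ, hne⟩ := hdiscr
    exact ⟨t, ht, fun h => hne (by rw [discrL_eq a (hyp t ht ξ), h, mul_zero])⟩
  have hcongr : ∀ ξ : ℝ, R ≤ |ξ| → EqOn (fun t => leviIntegrand a b t ξ)
      (perturbedResidue (depressedA a) (depressedB a) (depressedCoeff a b) (1 / ξ ^ 2))
      (uIcc 0 T) := by
    intro ξ hξ t ht
    rw [uIcc_of_le hT.le] at ht
    exact leviIntegrand_eq a b (abs_pos.mp (hR.trans_le hξ)) (hdiff 1 t ht) (hdiff 2 t ht) (hs t ht)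
  have hlog : ∀ (C ξ : ℝ), R ≤ |ξ| →
      ((IntervalIntegrable (fun t => leviIntegrand a b t ξ) volume 0 T ∧
        ∫ t in (0 : ℝ)..T, leviIntegrand a b t ξ ≤ C * Real.log (1 + |ξ|)) ↔
      (IntervalIntegrable (perturbedResidue (depressedA a) (depressedB a) (depressedCoeff a b)
        (1 / ξ ^ 2)) volume 0 T ∧
        ∫ t in (0 : ℝ)..T, perturbedResidue (depressedA a) (depressedB a) (depressedCoeff a b)
        (1 / ξ ^ 2) t ≤ C * Real.log (1 + |ξ|))) := by
    intro C ξ hξ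
    rw [intervalIntegral.integral_congr (hcongr ξ hξ),
      intervalIntegrable_congr fun t ht => hcongr ξ hξ (uIoc_subset_uIcc ht)]
  constructor
  · rintro ⟨C, hC, h⟩
    obtain ⟨K, hK, hle⟩ := exists_pointwise_bound hT hR hA hB hd hA0 hAB hfin hC.le
      fun ξ hξ => (hlog C ξ hξ).mp (h ξ hξ)
    refine ⟨hfin.toFinset, fun t ht => hsub ?_, K, hK, fun i hi t ht ξ => ?_⟩
    · exact (hfin.mem_toFinset.mp ht).1
    · exact (pointwise_iff a b (hdiff 1 t ht) (hdiff 2 t ht) (hs t ht) _ K ξ).mpr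
        (fun k => mul_le_mul_of_nonneg_left (hle t ht k) (sq_nonneg ξ)) i hi
  · rintro ⟨S, -, K, hK, h⟩
    obtain ⟨C, hC, hle⟩ := exists_integral_perturbedResidue_le (S := S) hT hR hA.continuousOn
      hB.continuousOn (fun j => (hd j).continuousOn) hA0 hAB hfin hK fun t ht k => by
        have := (pointwise_iff a b (hdiff 1 t ht) (hdiff 2 t ht) (hs t ht) _ K 1).mp
          (fun i hi => h i hi t ht 1) k
        simpa using this
    exact ⟨C, hC, fun ξ hξ => (hlog C ξ hξ).mpr (hle ξ hξ)⟩
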